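/- Let $d\ge 2$. Let $\mathcal E(\mathbb R^d)$ be the space of smooth functions $\mathbb R^d\to\mathbb C$ with the topology of uniform convergence of the derivatives of every order on compact sets, and let $\mathcal E'(\mathbb R^d)$ be its topological dual, the space of compactly supported distributions. Let $$\Gamma=\{(z,\theta)\in\mathbb R^d\times\mathbb R^d:\ |\theta|=1,\ z\cdot\theta=0\}$$ be the manifold of oriented lines, $(z,\theta)$ standing for the line $\{z+s\theta: s\in\mathbb R\}$. For a smooth function $\eta:\Gamma\to\mathbb C$ put $$X^*\eta(x)=\int_{S^{d-1}}\eta\bigl(x-(x\cdot\theta)\theta,\theta\bigr)\,\mathrm d\theta ,$$ which is a smooth function of $x\in\mathbb R^d$, and define the X-ray transform $Xf$ of $f\in\mathcal E'(\mathbb R^d)$ by duality, $\langle Xf,\eta\rangle=\langle f,X^*\eta\rangle$. For an open set $V\subset\mathbb R^d$ we say that $Xf$ vanishes on all lines that intersect $V$ if $\langle Xf,\eta\rangle=0$ for every smooth $\eta$ whose support is a compact subset of the set $\Gamma_V$ of all lines in $\Gamma$ that intersect $V$. Let $R>r>0$, and let $f\in\mathcal E'(\mathbb R^d)$ satisfy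 $\operatorname{spt}(f)\subset\overline B(0,R)\setminus B(0,r)$, where $B$ and $\overline B$ denote open and closed balls. If $Xf$ vanishes on all lines that intersect $B(0,r)$, then $f=0$. -/

import Mathlib

open scoped ContDiff

noncomputable section

/-! ### Smooth functions and compactly supported distributions on `ℝᵈ` -/

/-- The smooth functions `ℝᵈ → ℂ`, as a subspace of all functions. -/
def smoothSubmodule (d : ℕ) : Submodule ℂ (EuclideanSpace ℝ (Fin d) → ℂ) where
  carrier := {φ | ContDiff ℝ ∞ φ}
  add_mem' := by
    intro φ ψ h₁ h₂
    exact ContDiff.add (𝕜 := ℝ) (n := ∞) (f := φ) (g := ψ) h₁ h₂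
  zero_mem' := by
    change ContDiff ℝ ∞ (fun _ : EuclideanSpace ℝ (Fin d) => (0 : ℂ))
    exact contDiff_const
  smul_mem' := by
    intro c φ h
    exact ContDiff.const_smul (𝕜 := ℝ) (n := ∞) (f := φ) c h

/-- The space `𝓔(ℝᵈ)` of smooth functions `ℝᵈ → ℂ`. This is a type of its own, so that it does not
inherit the topology of pointwise convergence. -/
def SmoothFunction (d : ℕ) : Type := smoothSubmodule d

namespace SmoothFunction

variable {d : ℕ}

instance : AddCommGroup (SmoothFunction d) := inferInstanceAs (AddCommGroup (smoothSubmodule d))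

instance : Module ℂ (SmoothFunction d) := inferInstanceAs (Module ℂ (smoothSubmodule d))

instance : FunLike (SmoothFunction d) (EuclideanSpace ℝ (Fin d)) ℂ where
  coe φ := φ.1
  coe_injective _ _ h := Subtype.ext h

theorem contDiff (φ : SmoothFunction d) : ContDiff ℝ ∞ φ := φ.2

/-- The `k`-th derivative of a smooth function, as a continuous map. -/
def derivMap (k : ℕ) (φ : SmoothFunction d) :
    C(EuclideanSpace ℝ (Fin d),
      ContinuousMultilinearMap ℝ (fun _ : Fin k => EuclideanSpace ℝ (Fin d)) ℂ) where
  toFun := iteratedFDeriv ℝ k φ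
  continuous_toFun := φ.contDiff.continuous_iteratedFDeriv (by exact_mod_cast le_top)

/-- The topology of uniform convergence of the derivatives of every order on compact sets:
`C(X, Y)` carries the compact-open topology. -/
instance : TopologicalSpace (SmoothFunction d) :=
  ⨅ k : ℕ, TopologicalSpace.induced (derivMap k) inferInstance

end SmoothFunction

/-- The space `𝓔'(ℝᵈ)` of compactly supported distributions: the topological dual of `𝓔(ℝᵈ)`. -/
abbrev CompactDistribution (d : ℕ) : Type := SmoothFunction d →L[ℂ] ℂ

/-! ### Oriented lines and smooth functions of lines -/

/-- The manifold `Γ` of oriented lines in `ℝᵈ`: the pair `(z, θ)` with `|θ| = 1` and `z ⊥ θ` stands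
for the line `{z + s θ : s ∈ ℝ}` with direction `θ`. -/
abbrev OrientedLine (d : ℕ) : Type :=
  {p : EuclideanSpace ℝ (Fin d) × EuclideanSpace ℝ (Fin d) // ‖p.2‖ = 1 ∧ inner ℝ p.1 p.2 = 0}

/-- The set of the oriented lines that intersect `V`. -/
def linesMeeting {d : ℕ} (V : Set (EuclideanSpace ℝ (Fin d))) : Set (OrientedLine d) :=
  {γ | ∃ s : ℝ, γ.1.1 + s • γ.1.2 ∈ V}

/-- Smoothness of a function on the embedded submanifold `Γ` of `ℝᵈ × ℝᵈ`: near every point of `Γ`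
the function is the restriction of a smooth function of the ambient space. -/
def IsSmoothOnLines {d : ℕ} (η : OrientedLine d → ℂ) : Prop :=
  ∀ γ : OrientedLine d, ∃ U : Set (EuclideanSpace ℝ (Fin d) × EuclideanSpace ℝ (Fin d)),
    IsOpen U ∧ γ.1 ∈ U ∧ ∃ g : EuclideanSpace ℝ (Fin d) × EuclideanSpace ℝ (Fin d) → ℂ,
      ContDiffOn ℝ ∞ g U ∧ ∀ γ' : OrientedLine d, γ'.1 ∈ U → η γ' = g γ'.1

/-- The space `𝓔(Γ)` of smooth functions `Γ → ℂ`. -/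
def smoothOnLines (d : ℕ) : Submodule ℂ (OrientedLine d → ℂ) where
  carrier := {η | IsSmoothOnLines η}
  add_mem' := by
    intro η₁ η₂ h₁ h₂ γ
    obtain ⟨U₁, o₁, m₁, g₁, c₁, e₁⟩ := h₁ γ
    obtain ⟨U₂, o₂, m₂, g₂, c₂, e₂⟩ := h₂ γ
    refine ⟨U₁ ∩ U₂, o₁.inter o₂, ⟨m₁, m₂⟩, g₁ + g₂,
      (c₁.mono Set.inter_subset_left).add (c₂.mono Set.inter_subset_right), fun γ' h => ?_⟩
    simp [e₁ γ' h.1, e₂ γ' h.2]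
  zero_mem' := fun γ => ⟨Set.univ, isOpen_univ, trivial, 0, contDiffOn_const, fun _ _ => rfl⟩
  smul_mem' := by
    intro c η h γ
    obtain ⟨U, o, m, g, hg, e⟩ := h γ
    exact ⟨U, o, m, c • g, hg.const_smul c, fun γ' h => by simp [e γ' h]⟩

/-! ### The formal adjoint of the X-ray transform, and the X-ray transform of distributions -/

/-- The oriented line `(x - (x · θ) θ, θ)` through the point `x` with direction `θ`. -/
def lineThrough {d : ℕ} (x : EuclideanSpace ℝ (Fin d))
    (θ : Metric.sphere (0 : EuclideanSpace ℝ (Fin d)) 1) : OrientedLine d :=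
  ⟨(x - inner ℝ x θ.1 • θ.1, θ.1), by
    have h : ‖θ.1‖ = 1 := norm_eq_of_mem_sphere θ
    refine ⟨h, ?_⟩
    rw [inner_sub_left, real_inner_smul_left, real_inner_self_eq_norm_sq, h]
    simp⟩

/-- A family of functions of `x`, indexed by the unit sphere, is jointly smooth if it extends
locally to a smooth function of the ambient space. -/
def IsSmoothFamily {d : ℕ} {G : Type} [NormedAddCommGroup G] [NormedSpace ℝ G]
    (F : EuclideanSpace ℝ (Fin d) → Metric.sphere (0 : EuclideanSpace ℝ (Fin d)) 1 → G) : Prop :=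
  ∀ (x₀ : EuclideanSpace ℝ (Fin d)) (θ₀ : Metric.sphere (0 : EuclideanSpace ℝ (Fin d)) 1),
    ∃ U : Set (EuclideanSpace ℝ (Fin d) × EuclideanSpace ℝ (Fin d)),
    IsOpen U ∧ (x₀, θ₀.1) ∈ U ∧ ∃ g : EuclideanSpace ℝ (Fin d) × EuclideanSpace ℝ (Fin d) → G,
      ContDiffOn ℝ ∞ g U ∧
      ∀ (x : EuclideanSpace ℝ (Fin d)) (θ : Metric.sphere (0 : EuclideanSpace ℝ (Fin d)) 1),
        (x, θ.1) ∈ U → F x θ = g (x, θ.1)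

namespace IsSmoothFamily

variable {d : ℕ} {G : Type} [NormedAddCommGroup G] [NormedSpace ℝ G]
  {F : EuclideanSpace ℝ (Fin d) → Metric.sphere (0 : EuclideanSpace ℝ (Fin d)) 1 → G}

theorem continuous (hF : IsSmoothFamily F) : Continuous (Function.uncurry F) := by
  rw [continuous_iff_continuousAt]
  rintro ⟨x₀, θ₀⟩
  obtain ⟨U, hU, hm, g, hg, e⟩ := hF x₀ θ₀
  have hi : Continuous fun p : EuclideanSpace ℝ (Fin d) ×
      Metric.sphere (0 : EuclideanSpace ℝ (Fin d)) 1 => (p.1, p.2.1) := by fun_prop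
  have h1 : ContinuousAt g (x₀, θ₀.1) := hg.continuousOn.continuousAt (hU.mem_nhds hm)
  have h2 := ContinuousAt.comp (x := (x₀, θ₀))
    (f := fun p : EuclideanSpace ℝ (Fin d) ×
      Metric.sphere (0 : EuclideanSpace ℝ (Fin d)) 1 => (p.1, p.2.1)) h1 hi.continuousAt
  refine h2.congr ?_
  filter_upwards [hi.continuousAt.preimage_mem_nhds (hU.mem_nhds hm)] with p hp
  exact (e p.1 p.2 hp).symm

theorem hasFDerivAt_aux
    {U : Set (EuclideanSpace ℝ (Fin d) × EuclideanSpace ℝ (Fin d))} (hU : IsOpen U)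
    {g : EuclideanSpace ℝ (Fin d) × EuclideanSpace ℝ (Fin d) → G} (hg : ContDiffOn ℝ ∞ g U)
    (e : ∀ x θ, (x, θ.1) ∈ U → F x θ = g (x, θ.1)) (x θ) (hx : (x, θ.1) ∈ U) :
    HasFDerivAt (fun y => F y θ)
      ((fderiv ℝ g (x, θ.1)).comp (ContinuousLinearMap.inl ℝ _ _)) x := by
  have h1 : HasFDerivAt g (fderiv ℝ g (x, θ.1)) (x, θ.1) :=
    ((hg.contDiffAt (hU.mem_nhds hx)).differentiableAt (by simp)).hasFDerivAt
  have h2 := HasFDerivAt.comp (g := g) x h1 (hasFDerivAt_prodMk_left (𝕜 := ℝ) x θ.1)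
  refine h2.congr_of_eventuallyEq ?_
  have hi : Continuous fun y : EuclideanSpace ℝ (Fin d) => (y, θ.1) := by fun_prop
  filter_upwards [hi.continuousAt.preimage_mem_nhds (hU.mem_nhds hx)] with y hy
  exact e y θ hy

theorem hasFDerivAt (hF : IsSmoothFamily F) (x θ) :
    HasFDerivAt (fun y => F y θ) (fderiv ℝ (fun y => F y θ) x) x := by
  obtain ⟨U, hU, hm, g, hg, e⟩ := hF x θ
  exact (hasFDerivAt_aux hU hg e x θ hm).differentiableAt.hasFDerivAt

theorem fderiv (hF : IsSmoothFamily F) :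
    IsSmoothFamily (fun x θ => fderiv ℝ (fun y => F y θ) x) := by
  intro x₀ θ₀
  obtain ⟨U, hU, hm, g, hg, e⟩ := hF x₀ θ₀
  refine ⟨U, hU, hm, fun p => (_root_.fderiv ℝ g p).comp (ContinuousLinearMap.inl ℝ _ _), ?_,
    fun x θ hx => (hasFDerivAt_aux hU hg e x θ hx).fderiv⟩
  exact (hg.fderiv_of_isOpen hU (by simp)).clm_comp contDiffOn_const

theorem integrable (hF : IsSmoothFamily F) (x) :
    MeasureTheory.Integrable (F x)
      (MeasureTheory.volume : MeasureTheory.Measure (EuclideanSpace ℝ (Fin d))).toSphere := by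
  have hc : Continuous (F x) := hF.continuous.comp (Continuous.prodMk_right x)
  exact hc.integrable_of_hasCompactSupport (HasCompactSupport.of_compactSpace _)

theorem hasFDerivAt_integral (hF : IsSmoothFamily F) (x₀) :
    HasFDerivAt (fun x => ∫ θ, F x θ
        ∂(MeasureTheory.volume : MeasureTheory.Measure (EuclideanSpace ℝ (Fin d))).toSphere)
      (∫ θ, _root_.fderiv ℝ (fun y => F y θ) x₀
        ∂(MeasureTheory.volume : MeasureTheory.Measure (EuclideanSpace ℝ (Fin d))).toSphere) x₀ := by
  have hK : IsCompact ((Metric.closedBall x₀ 1) ×ˢ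
      (Set.univ : Set (Metric.sphere (0 : EuclideanSpace ℝ (Fin d)) 1))) :=
    (isCompact_closedBall x₀ 1).prod isCompact_univ
  obtain ⟨C, hC⟩ := hK.exists_bound_of_continuousOn hF.fderiv.continuous.continuousOn
  refine hasFDerivAt_integral_of_dominated_of_fderiv_le (bound := fun _ => C)
    (F := fun x θ => F x θ) (F' := fun x θ => _root_.fderiv ℝ (fun y => F y θ) x)
    (Metric.ball_mem_nhds x₀ one_pos) ?_ (hF.integrable x₀) (hF.fderiv.integrable x₀).1 ?_
    (MeasureTheory.integrable_const C) ?_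
  · exact Filter.Eventually.of_forall fun x => (hF.integrable x).1
  · exact Filter.Eventually.of_forall fun θ x hx =>
      hC (x, θ) ⟨Metric.ball_subset_closedBall hx, trivial⟩
  · exact Filter.Eventually.of_forall fun θ x _ => hF.hasFDerivAt x θ

end IsSmoothFamily

theorem IsSmoothFamily.contDiff_integral_nat {d : ℕ} (n : ℕ) :
    ∀ {G : Type} [NormedAddCommGroup G] [NormedSpace ℝ G]
    {F : EuclideanSpace ℝ (Fin d) → Metric.sphere (0 : EuclideanSpace ℝ (Fin d)) 1 → G},
    IsSmoothFamily F → ContDiff ℝ n (fun x => ∫ θ, F x θ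
      ∂(MeasureTheory.volume : MeasureTheory.Measure (EuclideanSpace ℝ (Fin d))).toSphere) := by
  induction n with
  | zero =>
    intro G _ _ F hF
    rw [Nat.cast_zero, contDiff_zero, continuous_iff_continuousAt]
    exact fun x => (hF.hasFDerivAt_integral x).continuousAt
  | succ n ih =>
    intro G _ _ F hF
    rw [Nat.cast_succ, contDiff_succ_iff_hasFDerivAt]
    exact ⟨_, ih hF.fderiv, hF.hasFDerivAt_integral⟩

/-- The value at `x` of `X^* η`: the integral of `η` over all oriented lines through `x`, with
respect to the surface measure of the unit sphere. -/
def backprojection {d : ℕ} (η : OrientedLine d → ℂ) (x : EuclideanSpace ℝ (Fin d)) : ℂ :=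
  ∫ θ, η (lineThrough x θ)
    ∂(MeasureTheory.volume : MeasureTheory.Measure (EuclideanSpace ℝ (Fin d))).toSphere

theorem IsSmoothOnLines.isSmoothFamily {d : ℕ} {η : OrientedLine d → ℂ} (hη : IsSmoothOnLines η) :
    IsSmoothFamily (fun x θ => η (lineThrough x θ)) := by
  intro x₀ θ₀
  obtain ⟨U, hU, hm, g, hg, e⟩ := hη (lineThrough x₀ θ₀)
  have hs : ContDiff ℝ ∞ (fun p : EuclideanSpace ℝ (Fin d) × EuclideanSpace ℝ (Fin d) =>
      (p.1 - inner ℝ p.1 p.2 • p.2, p.2)) :=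
    (contDiff_fst.sub ((contDiff_fst.inner ℝ contDiff_snd).smul contDiff_snd)).prodMk contDiff_snd
  exact ⟨_, hU.preimage hs.continuous, hm, fun p => g (p.1 - inner ℝ p.1 p.2 • p.2, p.2),
    hg.comp hs.contDiffOn (fun _ h => h), fun x θ hx => e (lineThrough x θ) hx⟩

/-- The formal adjoint `X^* : 𝓔(Γ) → 𝓔(ℝᵈ)` of the X-ray transform. -/
def xrayAdjoint (d : ℕ) : smoothOnLines d →ₗ[ℂ] SmoothFunction d where
  toFun η := ⟨backprojection η.1,
    contDiff_infty.2 fun n => IsSmoothFamily.contDiff_integral_nat n η.2.isSmoothFamily⟩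
  map_add' η₁ η₂ := by
    refine Subtype.ext (funext fun x => ?_)
    exact MeasureTheory.integral_add (η₁.2.isSmoothFamily.integrable x)
      (η₂.2.isSmoothFamily.integrable x)
  map_smul' c η := by
    refine Subtype.ext (funext fun x => ?_)
    exact MeasureTheory.integral_const_mul c _

/-- The X-ray transform `X f` of a compactly supported distribution, as a functional on `𝓔(Γ)`,
defined by duality: `⟨X f, η⟩ = ⟨f, X^* η⟩`. -/
def xray {d : ℕ} (f : CompactDistribution d) : smoothOnLines d →ₗ[ℂ] ℂ :=
  f.toLinearMap ∘ₗ xrayAdjoint d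

/-- `X f` vanishes on all lines that intersect `V`: the restriction of `X f` to the set `Γ_V` of
these lines is zero, that is, `⟨X f, η⟩ = 0` for every smooth `η` with compact support in `Γ_V`. -/
def XrayVanishesOnLinesMeeting {d : ℕ} (f : CompactDistribution d)
    (V : Set (EuclideanSpace ℝ (Fin d))) : Prop :=
  ∀ η : smoothOnLines d, HasCompactSupport η.1 → tsupport η.1 ⊆ linesMeeting V → xray f η = 0

end

/-!
# Uniqueness for the X-ray transform on the lines through a ball outside the support

In polar coordinates, the normal operator `X^* X` is the convolution with `2 |x|^(1-d)`
(`backprojection_testFunctionXray`). For a test function `φ` supported near the origin,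
`X φ` is an admissible function of lines, so the hypothesis on `X f` says that `f` annihilates
`φ * |x|^(1-d)` for all such `φ`. Call a function `h` *annihilated* if `f` annihilates `φ * h` for
all these `φ` (`CompactDistribution.AnnihilatesConvolutions`). Since `f` lives at a distance from the
origin, only the values of `h` away from the origin matter, and the singularity of the kernel can be
smoothed out: `|x|^2` is replaced by a positive smooth function.

The annihilated functions form a linear space, closed under differentiation (integrate by parts)
and under locally uniform limits (put all derivatives on `φ`). Now:

* The Laplacian sends `|x|^(-2μ)` to `2μ (2μ + 2 - d) |x|^(-2μ-2)`. For `2μ = d - 1 + 2j` the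
  factor `2μ + 2 - d = 2j + 1` does not vanish, so all `|x|^(1-d-2j)` are annihilated. This is where
  the exponent matters: for the Newtonian kernel `|x|^(2-d)` the factor would vanish at once.
* Differentiating these kernels and using Euler's identity, all `p(x) |x|^(1-d-2j)` with `p`
  homogeneous of degree at most `j` are annihilated (`polyKernel_of_isHomogeneous`). With
  `w = x / |x|^2` this includes `|x|^(1-d) q(w)` for every polynomial `q`.
* By the Stone-Weierstrass theorem in the variable `w`, every continuous function is annihilated
  (`of_polyKernel_one`), since the annulus is compact and does not contain the origin.

Letting `φ` run through an approximate identity, `f` annihilates every smooth function.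
-/

noncomputable section

open Filter Topology MeasureTheory
open scoped Convolution

/-! ### Distributions and their supports -/

namespace SmoothFunction

variable {d : ℕ}

theorem tendsto_of_iteratedFDeriv {ι : Type*} {l : Filter ι} {F : ι → SmoothFunction d}
    {ψ : SmoothFunction d}
    (h : ∀ (k : ℕ) (K : Set (EuclideanSpace ℝ (Fin d))), IsCompact K → ∀ ε > 0,
      ∀ᶠ i in l, ∀ x ∈ K, dist (iteratedFDeriv ℝ k (F i) x) (iteratedFDeriv ℝ k ψ x) < ε) :
    Tendsto F l (𝓝 ψ) := by
  rw [nhds_iInf, tendsto_iInf]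
  intro k
  rw [nhds_induced, tendsto_comap_iff, ContinuousMap.tendsto_iff_forall_isCompact_tendstoUniformlyOn]
  intro K hK
  rw [Metric.tendstoUniformlyOn_iff]
  intro ε hε
  filter_upwards [h k K hK ε hε] with i hi x hx
  rw [dist_comm]
  exact hi x hx

/-- The product of a smooth function with a smooth real function. -/
def cutoff (ρ : EuclideanSpace ℝ (Fin d) → ℝ) (hρ : ContDiff ℝ ∞ ρ) (ψ : SmoothFunction d) :
    SmoothFunction d :=
  ⟨fun x => ρ x • ψ x, hρ.smul ψ.contDiff⟩

@[simp] theorem cutoff_apply (ρ : EuclideanSpace ℝ (Fin d) → ℝ) (hρ : ContDiff ℝ ∞ ρ)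
    (ψ : SmoothFunction d) (x : EuclideanSpace ℝ (Fin d)) : cutoff ρ hρ ψ x = ρ x • ψ x := rfl

@[simp] theorem sum_apply {ι : Type*} (s : Finset ι) (F : ι → SmoothFunction d)
    (x : EuclideanSpace ℝ (Fin d)) : (∑ i ∈ s, F i) x = ∑ i ∈ s, F i x := by
  let ev : SmoothFunction d →+ ℂ :=
    { toFun := fun ψ => ψ x, map_zero' := rfl, map_add' := fun _ _ => rfl }
  exact map_sum ev F s

theorem tsupport_cutoff_subset (ρ : EuclideanSpace ℝ (Fin d) → ℝ) (hρ : ContDiff ℝ ∞ ρ)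
    (ψ : SmoothFunction d) : tsupport (cutoff ρ hρ ψ) ⊆ tsupport ρ ∩ tsupport ψ :=
  Set.subset_inter (tsupport_smul_subset_left ρ ψ) (tsupport_smul_subset_right ρ ψ)

end SmoothFunction

namespace CompactDistribution

open SmoothFunction

variable {d : ℕ}

/-- A partition of unity reduces the vanishing of `f ψ` to test functions with small support. -/
theorem eq_zero_of_hasCompactSupport (f : CompactDistribution d) (ψ : SmoothFunction d)
    (hc : HasCompactSupport ψ)
    (hψ : Disjoint (tsupport ψ) (Distribution.dsupport (f : SmoothFunction d → ℂ))) : f ψ = 0 := by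
  have hx : ∀ x : tsupport ψ, ∃ s : Set (EuclideanSpace ℝ (Fin d)),
      Distribution.IsVanishingOn (f : SmoothFunction d → ℂ) s ∧ IsOpen s ∧ x.1 ∈ s := fun x =>
    (Distribution.notMem_dsupport_iff x.1).1 (Set.disjoint_left.1 hψ x.2)
  choose U hU hUo hxU using hx
  obtain ⟨t, ht⟩ := hc.elim_finite_subcover U hUo
    (fun x hx => Set.mem_iUnion.2 ⟨⟨x, hx⟩, hxU ⟨x, hx⟩⟩)
  obtain ⟨ρ, hρ⟩ := SmoothPartitionOfUnity.exists_isSubordinate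
    (modelWithCornersSelf ℝ (EuclideanSpace ℝ (Fin d))) (isClosed_tsupport ψ)
    (fun i : t => U i.1) (fun i => hUo i.1) (fun x hx => by
      obtain ⟨i, hi, hxi⟩ := Set.mem_iUnion₂.1 (ht hx)
      exact Set.mem_iUnion.2 ⟨⟨i, hi⟩, hxi⟩)
  have hsm : ∀ i, ContDiff ℝ ∞ (ρ i) := fun i => (ρ i).contMDiff.contDiff
  have hsum : ψ = ∑ i : t, cutoff (ρ i) (hsm i) ψ := by
    refine DFunLike.ext _ _ fun x => ?_
    rw [sum_apply]
    simp only [cutoff_apply, ← Finset.sum_smul]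
    by_cases hx : x ∈ tsupport ψ
    · rw [← finsum_eq_sum_of_fintype, ρ.sum_eq_one hx, one_smul]
    · rw [image_eq_zero_of_notMem_tsupport hx, smul_zero]
  rw [hsum, map_sum]
  refine Finset.sum_eq_zero fun i _ => hU i.1 _ ?_
  exact ((tsupport_cutoff_subset _ _ _).trans Set.inter_subset_left).trans (hρ i)

/-- A compactly supported distribution vanishes on every smooth function whose support, compact or
not, avoids the support of the distribution. -/
theorem eq_zero_of_disjoint_tsupport (f : CompactDistribution d) (ψ : SmoothFunction d)
    (hψ : Disjoint (tsupport ψ) (Distribution.dsupport (f : SmoothFunction d → ℂ))) : f ψ = 0 := by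
  let χ : ℕ → ContDiffBump (0 : EuclideanSpace ℝ (Fin d)) := fun n =>
    ⟨n + 1, n + 2, by positivity, by linarith⟩
  have h0 : ∀ n, f (cutoff (χ n) (χ n).contDiff ψ) = 0 := by
    intro n
    apply eq_zero_of_hasCompactSupport
    · exact HasCompactSupport.smul_right (f := χ n) (f' := ψ) (χ n).hasCompactSupport
    · exact hψ.mono_left ((tsupport_cutoff_subset _ _ _).trans Set.inter_subset_right)
  have ht : Tendsto (fun n => cutoff (χ n) (χ n).contDiff ψ) atTop (𝓝 ψ) := by
    refine tendsto_of_iteratedFDeriv fun k K hK ε hε => ?_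
    obtain ⟨M, hM⟩ := hK.isBounded.subset_ball 0
    filter_upwards [eventually_ge_atTop ⌈M⌉₊] with n hn x hx
    have hxn : x ∈ Metric.ball (0 : EuclideanSpace ℝ (Fin d)) (χ n).rIn := by
      have h1 := hM hx
      rw [Metric.mem_ball] at h1 ⊢
      have : M ≤ n := (Nat.le_ceil M).trans (by exact_mod_cast hn)
      change _ < (n : ℝ) + 1
      linarith
    have he : (cutoff (χ n) (χ n).contDiff ψ : EuclideanSpace ℝ (Fin d) → ℂ) =ᶠ[𝓝 x] ψ := by
      filter_upwards [Metric.isOpen_ball.mem_nhds hxn] with y hy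
      rw [cutoff_apply, (χ n).one_of_mem_closedBall (Metric.ball_subset_closedBall hy), one_smul]
    rw [(he.iteratedFDeriv ℝ k).eq_of_nhds, dist_self]
    exact hε
  have h2 := (f.continuous.tendsto ψ).comp ht
  exact tendsto_nhds_unique h2 (by simp [Function.comp_def, h0])

theorem congr_of_eqOn (f : CompactDistribution d) {ψ₁ ψ₂ : SmoothFunction d}
    {U : Set (EuclideanSpace ℝ (Fin d))} (hU : IsOpen U)
    (hf : Distribution.dsupport (f : SmoothFunction d → ℂ) ⊆ U) (h : Set.EqOn ψ₁ ψ₂ U) :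
    f ψ₁ = f ψ₂ := by
  rw [← sub_eq_zero, ← map_sub]
  refine eq_zero_of_disjoint_tsupport f _ ?_
  refine Set.disjoint_of_subset_right hf (Set.disjoint_left.2 fun x hx hxU => ?_)
  have : tsupport (ψ₁ - ψ₂ : SmoothFunction d) ⊆ Uᶜ := by
    refine closure_minimal (fun y hy hyU => hy ?_) hU.isClosed_compl
    exact sub_eq_zero.2 (h hyU)
  exact this hx hxU

end CompactDistribution

/-! ### Derivatives of convolutions -/

theorem hasCompactSupport_of_tsupport_subset_closedBall {X F : Type*} [PseudoMetricSpace X]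
    [ProperSpace X] [Zero F] {φ : X → F} {x : X} {δ : ℝ}
    (h : tsupport φ ⊆ Metric.closedBall x δ) : HasCompactSupport φ :=
  (isCompact_closedBall x δ).of_isClosed_subset (isClosed_tsupport φ) h

/-- A convolution is determined near `x` by the values of the second factor near `x - supp φ`. -/
theorem convolution_congr_of_eqOn_closedBall {E F G F' : Type*}
    [NormedAddCommGroup E] [MeasurableSpace E] {μ : Measure E} [NormedAddCommGroup F]
    [NormedSpace ℝ F] [NormedAddCommGroup G] [NormedSpace ℝ G] [NormedAddCommGroup F']
    [NormedSpace ℝ F'] (L : F →L[ℝ] G →L[ℝ] F') {φ : E → F} {δ : ℝ}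
    (hφ : tsupport φ ⊆ Metric.closedBall 0 δ) {g h : E → G} {x : E}
    (hgh : Set.EqOn g h (Metric.closedBall x δ)) : (φ ⋆[L, μ] g) x = (φ ⋆[L, μ] h) x := by
  refine integral_congr_ae (Eventually.of_forall fun y => ?_)
  by_cases hy : y ∈ tsupport φ
  · have : x - y ∈ Metric.closedBall x δ := by
      have := hφ hy
      rw [mem_closedBall_zero_iff] at this
      simpa [dist_eq_norm] using this
    simp only [hgh this]
  · simp [image_eq_zero_of_notMem_tsupport hy]

section Convolution

variable {E : Type} [NormedAddCommGroup E] [NormedSpace ℝ E] [FiniteDimensional ℝ E]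
  [MeasurableSpace E] [BorelSpace E] {μ : Measure E} [μ.IsAddHaarMeasure]

/-- All derivatives of a convolution with a fixed test function are controlled by the supremum norm
of the other factor. The target spaces vary because the induction passes to the derivative of `φ`. -/
theorem exists_norm_iteratedFDeriv_convolution_le (k : ℕ) :
    ∀ {F G F' : Type} [NormedAddCommGroup F] [NormedSpace ℝ F] [NormedAddCommGroup G]
      [NormedSpace ℝ G] [NormedAddCommGroup F'] [NormedSpace ℝ F'] (L : F →L[ℝ] G →L[ℝ] F')
      {φ : E → F}, ContDiff ℝ ∞ φ → HasCompactSupport φ →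
      ∃ C, ∀ (h : E → G) (M : ℝ), Continuous h → (∀ y, ‖h y‖ ≤ M) → ∀ x,
        ‖iteratedFDeriv ℝ k (φ ⋆[L, μ] h) x‖ ≤ C * M := by
  induction k with
  | zero =>
    intro F G F' _ _ _ _ _ _ L φ hφ hc
    refine ⟨∫ y, ‖L‖ * ‖φ y‖ ∂μ, fun h M _ hM x => ?_⟩
    rw [norm_iteratedFDeriv_zero, ← integral_mul_const]
    refine norm_integral_le_of_norm_le ?_ (Eventually.of_forall fun y => ?_)
    · exact ((hφ.continuous.integrable_of_hasCompactSupport hc).norm.const_mul _).mul_const _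
    · refine (L.le_opNorm₂ _ _).trans ?_
      exact mul_le_mul_of_nonneg_left (hM _) (by positivity)
  | succ k ih =>
    intro F G F' _ _ _ _ _ _ L φ hφ hc
    obtain ⟨C, hC⟩ := ih (L.precompL E) (φ := fderiv ℝ φ) (hφ.fderiv_right (by simp))
      (hc.fderiv ℝ)
    refine ⟨C, fun h M hh hM x => ?_⟩
    have : fderiv ℝ (φ ⋆[L, μ] h) = fderiv ℝ φ ⋆[L.precompL E, μ] h := by
      funext y
      exact (hc.hasFDerivAt_convolution_left L (hφ.of_le (by simp))
        hh.locallyIntegrable y).fderiv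
    rw [← norm_iteratedFDeriv_fderiv, this]
    exact hC h M hh hM x

/-- The derivative of a convolution falls on the second factor, which need not have compact support
if the first one does. -/
theorem HasCompactSupport.hasFDerivAt_convolution_left_of_contDiff {F G F' : Type}
    [NormedAddCommGroup F] [NormedSpace ℝ F] [NormedAddCommGroup G] [NormedSpace ℝ G]
    [NormedAddCommGroup F'] [NormedSpace ℝ F'] (L : F →L[ℝ] G →L[ℝ] F') {φ : E → F} {g : E → G}
    (hc : HasCompactSupport φ) (hφ : Continuous φ) (hg : ContDiff ℝ 1 g) (x : E) :
    HasFDerivAt (φ ⋆[L, μ] g) ((φ ⋆[L.precompR E, μ] fderiv ℝ g) x) x := by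
  obtain ⟨δ, hδ0, hδ⟩ : ∃ δ, 0 < δ ∧ tsupport φ ⊆ Metric.closedBall 0 δ := by
    obtain ⟨δ, hδ⟩ := hc.isBounded.subset_closedBall 0
    exact ⟨max δ 1, by simp, hδ.trans (Metric.closedBall_subset_closedBall (le_max_left _ _))⟩
  let χ : ContDiffBump x := ⟨δ + 2, δ + 3, by linarith, by linarith⟩
  have hχ : ∀ y ∈ Metric.ball x (δ + 2), χ y • g y = g y := fun y hy => by
    rw [χ.one_of_mem_closedBall (Metric.ball_subset_closedBall hy), one_smul]
  have h1 := (χ.hasCompactSupport.smul_right (f' := g)).hasFDerivAt_convolution_right L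
    (hφ.locallyIntegrable (μ := μ)) (χ.contDiff.smul hg) x
  have h2 : (φ ⋆[L.precompR E, μ] fderiv ℝ fun y => χ y • g y) x =
      (φ ⋆[L.precompR E, μ] fderiv ℝ g) x := by
    refine convolution_congr_of_eqOn_closedBall _ hδ fun y hy => ?_
    refine Filter.EventuallyEq.fderiv_eq ?_
    have hy' : y ∈ Metric.ball x (δ + 2) := by
      rw [Metric.mem_closedBall] at hy; rw [Metric.mem_ball]; linarith
    filter_upwards [Metric.isOpen_ball.mem_nhds hy'] with z hz using hχ z hz
  rw [← h2]
  refine h1.congr_of_eventuallyEq ?_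
  filter_upwards [Metric.ball_mem_nhds x one_pos] with y hy
  refine convolution_congr_of_eqOn_closedBall _ hδ fun z hz => (hχ z ?_).symm
  rw [Metric.mem_closedBall] at hz; rw [Metric.mem_ball] at hy ⊢
  linarith [dist_triangle z y x]

/-- Integration by parts: a directional derivative can be moved from one factor of a convolution to
the other. -/
theorem convolution_fderiv_apply_comm {φ g : E → ℝ} (hc : HasCompactSupport φ)
    (hφ : ContDiff ℝ 1 φ) (hg : ContDiff ℝ 1 g) (v : E) :
    (fun y => fderiv ℝ φ y v) ⋆[ContinuousLinearMap.lsmul ℝ ℝ, μ] g =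
      φ ⋆[ContinuousLinearMap.lsmul ℝ ℝ, μ] fun y => fderiv ℝ g y v := by
  funext x
  have h1 := hc.hasFDerivAt_convolution_left (μ := μ) (ContinuousLinearMap.lsmul ℝ ℝ) hφ
    hg.continuous.locallyIntegrable x
  have h2 := hc.hasFDerivAt_convolution_left_of_contDiff (μ := μ) (ContinuousLinearMap.lsmul ℝ ℝ)
    hφ.continuous hg x
  have h3 := congrArg (fun T : E →L[ℝ] ℝ => T v) (h1.unique h2)
  have e1 := (hc.fderiv ℝ).convolutionExists_left (μ := μ)
    ((ContinuousLinearMap.lsmul ℝ ℝ : ℝ →L[ℝ] ℝ →L[ℝ] ℝ).precompL E)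
    (hφ.continuous_fderiv one_ne_zero) hg.continuous.locallyIntegrable x
  have e2 := hc.convolutionExists_left (μ := μ)
    ((ContinuousLinearMap.lsmul ℝ ℝ : ℝ →L[ℝ] ℝ →L[ℝ] ℝ).precompR E)
    hφ.continuous (hg.continuous_fderiv one_ne_zero).locallyIntegrable x
  simp only [convolution] at h3
  rw [ContinuousLinearMap.integral_apply e1, ContinuousLinearMap.integral_apply e2] at h3
  exact h3

/-- Mollification commutes with differentiation, so the derivatives of `φ * g` are as close to those
of `g` as these oscillate on balls of the radius of the support of `φ`. -/
theorem ContDiffBump.dist_iteratedFDeriv_normed_convolution_le (φ : ContDiffBump (0 : E)) (k : ℕ) :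
    ∀ {G : Type} [NormedAddCommGroup G] [NormedSpace ℝ G] [CompleteSpace G] {g : E → G} {x : E}
      {ε : ℝ}, ContDiff ℝ ∞ g →
      (∀ y ∈ Metric.ball x φ.rOut, dist (iteratedFDeriv ℝ k g y) (iteratedFDeriv ℝ k g x) ≤ ε) →
      dist (iteratedFDeriv ℝ k (φ.normed μ ⋆[ContinuousLinearMap.lsmul ℝ ℝ, μ] g) x)
        (iteratedFDeriv ℝ k g x) ≤ ε := by
  induction k with
  | zero =>
    intro G _ _ _ g x ε hg h
    simp only [iteratedFDeriv_zero_eq_comp, Function.comp_apply, LinearIsometryEquiv.dist_map] at h ⊢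
    exact φ.dist_normed_convolution_le hg.continuous.aestronglyMeasurable h
  | succ k ih =>
    intro G _ _ _ g x ε hg h
    have hd : fderiv ℝ (φ.normed μ ⋆[ContinuousLinearMap.lsmul ℝ ℝ, μ] g) =
        φ.normed μ ⋆[ContinuousLinearMap.lsmul ℝ ℝ, μ] fderiv ℝ g := by
      funext y
      exact (φ.hasCompactSupport_normed.hasFDerivAt_convolution_left_of_contDiff
        (ContinuousLinearMap.lsmul ℝ ℝ) φ.continuous_normed (hg.of_le (by simp)) y).fderiv
    simp only [iteratedFDeriv_succ_eq_comp_right, Function.comp_apply,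
      LinearIsometryEquiv.dist_map] at h ⊢
    rw [hd]
    exact ih (hg.fderiv_right (by simp)) h

end Convolution

/-! ### Distributions that annihilate convolutions -/

namespace SmoothFunction

variable {d : ℕ}

/-- A smooth real function, as an element of `𝓔(ℝᵈ)`. -/
def ofReal (u : EuclideanSpace ℝ (Fin d) → ℝ) (hu : ContDiff ℝ ∞ u) : SmoothFunction d :=
  ⟨fun x => (u x : ℂ), Complex.ofRealCLM.contDiff.comp hu⟩

@[simp] theorem ofReal_apply (u : EuclideanSpace ℝ (Fin d) → ℝ) (hu : ContDiff ℝ ∞ u)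
    (x : EuclideanSpace ℝ (Fin d)) : ofReal u hu x = u x := rfl

theorem dist_iteratedFDeriv_ofReal {u v : EuclideanSpace ℝ (Fin d) → ℝ}
    (hu : ContDiff ℝ ∞ u) (hv : ContDiff ℝ ∞ v) (k : ℕ) (x : EuclideanSpace ℝ (Fin d)) :
    dist (iteratedFDeriv ℝ k (ofReal u hu) x) (iteratedFDeriv ℝ k (ofReal v hv) x) =
      dist (iteratedFDeriv ℝ k u x) (iteratedFDeriv ℝ k v x) := by
  have hk : (k : WithTop ℕ∞) ≤ ∞ := by exact_mod_cast le_top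
  have h1 : ∀ w (hw : ContDiff ℝ ∞ w), iteratedFDeriv ℝ k (ofReal w hw) x =
      Complex.ofRealCLM.compContinuousMultilinearMap (iteratedFDeriv ℝ k w x) := fun w hw =>
    Complex.ofRealCLM.iteratedFDeriv_comp_left (f := w) hw.contDiffAt hk
  rw [h1 u hu, h1 v hv, dist_eq_norm, dist_eq_norm]
  have h2 := Complex.ofRealLI.norm_compContinuousMultilinearMap
    (iteratedFDeriv ℝ k u x - iteratedFDeriv ℝ k v x)
  rw [← h2]
  congr 1
  ext m
  simp

end SmoothFunction

namespace CompactDistribution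

open SmoothFunction

variable {d : ℕ}

/-- `f` annihilates the convolutions of `h` with all test functions supported in the closed ball of
radius `δ` about the origin. In terms of distributions, `f * ȟ = 0` on a ball about the origin,
where `ȟ x = h (-x)`. -/
def AnnihilatesConvolutions (f : CompactDistribution d) (δ : ℝ)
    (h : EuclideanSpace ℝ (Fin d) → ℝ) : Prop :=
  ∀ φ : EuclideanSpace ℝ (Fin d) → ℝ, ContDiff ℝ ∞ φ → tsupport φ ⊆ Metric.closedBall 0 δ →
    ∀ hc : ContDiff ℝ ∞ (φ ⋆[ContinuousLinearMap.lsmul ℝ ℝ, volume] h),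
      f (ofReal (φ ⋆[ContinuousLinearMap.lsmul ℝ ℝ, volume] h) hc) = 0

namespace AnnihilatesConvolutions

variable {f : CompactDistribution d} {δ : ℝ} {g h : EuclideanSpace ℝ (Fin d) → ℝ}

theorem zero : AnnihilatesConvolutions f δ 0 := by
  intro φ _ _ hc
  have : ofReal (φ ⋆[ContinuousLinearMap.lsmul ℝ ℝ, volume] 0) hc = 0 := by
    refine DFunLike.ext _ _ fun x => ?_
    rw [ofReal_apply, convolution_zero]
    exact Complex.ofReal_zero
  rw [this, map_zero]

theorem add (hg : AnnihilatesConvolutions f δ g) (hh : AnnihilatesConvolutions f δ h)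
    (cg : Continuous g) (ch : Continuous h) : AnnihilatesConvolutions f δ (g + h) := by
  intro φ hφ hs hc
  have hφc := hasCompactSupport_of_tsupport_subset_closedBall hs
  have hcg := hφc.contDiff_convolution_left (ContinuousLinearMap.lsmul ℝ ℝ) (n := ⊤) hφ
    (cg.locallyIntegrable (μ := volume))
  have hch := hφc.contDiff_convolution_left (ContinuousLinearMap.lsmul ℝ ℝ) (n := ⊤) hφ
    (ch.locallyIntegrable (μ := volume))
  have : ofReal _ hc = ofReal _ hcg + ofReal _ hch := by
    refine DFunLike.ext _ _ fun x => ?_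
    have := congrFun (ConvolutionExists.distrib_add
      (hφc.convolutionExists_left (ContinuousLinearMap.lsmul ℝ ℝ) hφ.continuous
        (cg.locallyIntegrable (μ := volume)))
      (hφc.convolutionExists_left (ContinuousLinearMap.lsmul ℝ ℝ) hφ.continuous
        (ch.locallyIntegrable (μ := volume)))) x
    rw [ofReal_apply, this, Pi.add_apply, Complex.ofReal_add]
    rfl
  rw [this, map_add, hg φ hφ hs hcg, hh φ hφ hs hch, add_zero]

theorem const_smul (hh : AnnihilatesConvolutions f δ h) (ch : Continuous h) (c : ℝ) :
    AnnihilatesConvolutions f δ (c • h) := by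
  intro φ hφ hs hc
  have hφc := hasCompactSupport_of_tsupport_subset_closedBall hs
  have hch := hφc.contDiff_convolution_left (ContinuousLinearMap.lsmul ℝ ℝ) (n := ⊤) hφ
    (ch.locallyIntegrable (μ := volume))
  have : ofReal _ hc = (c : ℂ) • ofReal _ hch := by
    refine DFunLike.ext _ _ fun x => ?_
    rw [ofReal_apply, convolution_smul, Pi.smul_apply, smul_eq_mul, Complex.ofReal_mul]
    rfl
  rw [this, map_smul, hh φ hφ hs hch, smul_zero]

theorem sum {ι : Type*} (s : Finset ι) {g : ι → EuclideanSpace ℝ (Fin d) → ℝ}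
    (hg : ∀ i ∈ s, AnnihilatesConvolutions f δ (g i)) (cg : ∀ i ∈ s, Continuous (g i)) :
    AnnihilatesConvolutions f δ (∑ i ∈ s, g i) := by
  have : AnnihilatesConvolutions f δ (∑ i ∈ s, g i) ∧ Continuous (∑ i ∈ s, g i) :=
    Finset.sum_induction g (fun h => AnnihilatesConvolutions f δ h ∧ Continuous h)
      (fun a b ha hb => ⟨ha.1.add hb.1 ha.2 hb.2, ha.2.add hb.2⟩) ⟨zero, continuous_zero⟩
      (fun i hi => ⟨hg i hi, cg i hi⟩)
  exact this.1

/-- Differentiating `h` amounts to differentiating the test function. -/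
theorem fderiv_apply (hh : AnnihilatesConvolutions f δ h) (ch : ContDiff ℝ ∞ h)
    (v : EuclideanSpace ℝ (Fin d)) :
    AnnihilatesConvolutions f δ fun x => fderiv ℝ h x v := by
  intro φ hφ hs
  rw [← convolution_fderiv_apply_comm (hasCompactSupport_of_tsupport_subset_closedBall hs)
    (hφ.of_le (by simp)) (ch.of_le (by simp)) v]
  exact hh _ ((hφ.fderiv_right (m := ∞) (by simp)).clm_apply contDiff_const)
    ((tsupport_fderiv_apply_subset ℝ v).trans hs)

/-- Only the values of `h` at distance at most `δ` from the support of `f` matter. -/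
theorem congr_of_eqOn {U : Set (EuclideanSpace ℝ (Fin d))} (hU : IsOpen U)
    (hf : Distribution.dsupport (f : SmoothFunction d → ℂ) ⊆ U)
    (hgh : ∀ x ∈ U, Set.EqOn g h (Metric.closedBall x δ)) (cg : Continuous g)
    (hg : AnnihilatesConvolutions f δ g) : AnnihilatesConvolutions f δ h := by
  intro φ hφ hs hc
  have hcg := (hasCompactSupport_of_tsupport_subset_closedBall hs).contDiff_convolution_left
    (ContinuousLinearMap.lsmul ℝ ℝ) (n := ⊤) hφ (cg.locallyIntegrable (μ := volume))
  rw [← hg φ hφ hs hcg]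
  refine CompactDistribution.congr_of_eqOn f hU hf fun x hx => ?_
  rw [ofReal_apply, ofReal_apply,
    convolution_congr_of_eqOn_closedBall (ContinuousLinearMap.lsmul ℝ ℝ) hs (hgh x hx)]

/-- Being annihilated is preserved under uniform limits: in the derivatives of `φ * e`, all
differentiations fall on `φ`, so these are small when `e` is. -/
theorem of_forall_sub_le (ch : Continuous h)
    (hh : ∀ ε > 0, ∃ e : EuclideanSpace ℝ (Fin d) → ℝ, Continuous e ∧ (∀ x, |e x| ≤ ε) ∧
      AnnihilatesConvolutions f δ (h - e)) : AnnihilatesConvolutions f δ h := by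
  intro φ hφ hs hc
  have hφc := hasCompactSupport_of_tsupport_subset_closedBall hs
  choose e ce he hhe using fun n : ℕ => hh (1 / ((n : ℝ) + 1)) Nat.one_div_pos_of_nat
  have hcont : ∀ g : EuclideanSpace ℝ (Fin d) → ℝ, Continuous g →
      ContDiff ℝ ∞ (φ ⋆[ContinuousLinearMap.lsmul ℝ ℝ, volume] g) := fun g cg =>
    hφc.contDiff_convolution_left (ContinuousLinearMap.lsmul ℝ ℝ) (n := ⊤) hφ
      cg.locallyIntegrable
  have hex := fun (g : EuclideanSpace ℝ (Fin d) → ℝ) (cg : Continuous g) =>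
    hφc.convolutionExists_left (ContinuousLinearMap.lsmul ℝ ℝ) hφ.continuous
      (cg.locallyIntegrable (μ := volume))
  have hfe : ∀ n, f (ofReal _ (hcont (e n) (ce n))) = f (ofReal _ hc) := by
    intro n
    have : ofReal _ hc = ofReal _ (hcont _ (ch.sub (ce n))) + ofReal _ (hcont (e n) (ce n)) := by
      refine DFunLike.ext _ _ fun x => ?_
      have := congrFun (ConvolutionExists.distrib_add (hex _ (ch.sub (ce n))) (hex _ (ce n))) x
      rw [sub_add_cancel] at this
      rw [ofReal_apply, this, Pi.add_apply, Complex.ofReal_add]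
      rfl
    rw [this, map_add]
    rw [hhe n φ hφ hs (hcont _ (ch.sub (ce n))), zero_add]
  have hlim : Tendsto (fun n => ofReal _ (hcont (e n) (ce n))) atTop
      (𝓝 (ofReal (fun _ => 0) contDiff_const)) := by
    refine tendsto_of_iteratedFDeriv fun k K _ ε hε => ?_
    obtain ⟨C, hC⟩ := exists_norm_iteratedFDeriv_convolution_le (μ := volume) k
      (ContinuousLinearMap.lsmul ℝ ℝ : ℝ →L[ℝ] ℝ →L[ℝ] ℝ) hφ hφc
    have h0 : Tendsto (fun n : ℕ => C * (1 / ((n : ℝ) + 1))) atTop (𝓝 0) := by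
      simpa using (tendsto_one_div_add_atTop_nhds_zero_nat (𝕜 := ℝ)).const_mul C
    filter_upwards [h0.eventually_lt_const hε] with n hn x _
    rw [dist_iteratedFDeriv_ofReal, iteratedFDeriv_fun_zero, Pi.zero_apply, dist_zero_right]
    exact (hC (e n) _ (ce n) (he n) x).trans_lt hn
  have h0 : ofReal (fun _ => 0) contDiff_const = (0 : SmoothFunction d) :=
    DFunLike.ext _ _ fun x => Complex.ofReal_zero
  have h1 := (f.continuous.tendsto _).comp hlim
  simp only [Function.comp_def, hfe, h0, map_zero] at h1
  exact tendsto_nhds_unique tendsto_const_nhds h1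

end AnnihilatesConvolutions

/-- Mollification recovers `f` from its action on convolutions. -/
theorem eq_zero_of_annihilatesConvolutions (f : CompactDistribution d) {δ : ℝ} (hδ : 0 < δ)
    (hf : ∀ h, ContDiff ℝ ∞ h → AnnihilatesConvolutions f δ h) : f = 0 := by
  have hreal : ∀ u (hu : ContDiff ℝ ∞ u), f (ofReal u hu) = 0 := by
    intro u hu
    let χ : ℕ → ContDiffBump (0 : EuclideanSpace ℝ (Fin d)) := fun n =>
      ⟨δ / (n + 2), δ / (n + 1), by positivity, by gcongr; linarith⟩
    have hχ : ∀ n, tsupport ((χ n).normed volume) ⊆ Metric.closedBall 0 δ := fun n => by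
      rw [ContDiffBump.tsupport_normed_eq]
      refine Metric.closedBall_subset_closedBall ?_
      change δ / ((n : ℝ) + 1) ≤ δ
      exact div_le_self hδ.le (by linarith [n.cast_nonneg (α := ℝ)])
    have hc : ∀ n, ContDiff ℝ ∞
        ((χ n).normed volume ⋆[ContinuousLinearMap.lsmul ℝ ℝ, volume] u) := fun n =>
      (χ n).hasCompactSupport_normed.contDiff_convolution_left _ (χ n).contDiff_normed
        hu.continuous.locallyIntegrable
    have hlim : Tendsto (fun n => ofReal _ (hc n)) atTop (𝓝 (ofReal u hu)) := by
      refine tendsto_of_iteratedFDeriv fun k K hK ε hε => ?_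
      -- Uniform continuity of the derivative on the unit neighbourhood of `K`.
      have huc := ((hK.cthickening (r := 1)).uniformContinuousOn_of_continuous
        (hu.continuous_iteratedFDeriv (m := k) (by exact_mod_cast le_top)).continuousOn)
      rw [Metric.uniformContinuousOn_iff] at huc
      obtain ⟨η, hη, huc⟩ := huc (ε / 2) (by positivity)
      have h0 : Tendsto (fun n : ℕ => δ * (1 / ((n : ℝ) + 1))) atTop (𝓝 0) := by
        simpa using (tendsto_one_div_add_atTop_nhds_zero_nat (𝕜 := ℝ)).const_mul δ
      filter_upwards [h0.eventually_lt_const (lt_min hη one_pos)] with n hn x hx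
      rw [mul_one_div] at hn
      rw [dist_iteratedFDeriv_ofReal]
      refine ((χ n).dist_iteratedFDeriv_normed_convolution_le k hu (ε := ε / 2)
        fun y hy => ?_).trans_lt (by linarith)
      have hyd : dist y x < min η 1 := (Metric.mem_ball.1 hy).trans hn
      refine (huc y ?_ x (Metric.self_subset_cthickening K hx) (hyd.trans_le (min_le_left _ _))).le
      exact Metric.mem_cthickening_of_dist_le y x 1 K hx (hyd.le.trans (min_le_right _ _))
    refine tendsto_nhds_unique ((f.continuous.tendsto _).comp hlim) ?_
    simp only [Function.comp_def]
    rw [show (fun n => f (ofReal _ (hc n))) = fun _ => 0 from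
      funext fun n => hf u hu _ (χ n).contDiff_normed (hχ n) (hc n)]
    exact tendsto_const_nhds
  ext ψ
  have hre : ContDiff ℝ ∞ fun x => (ψ x).re := Complex.reCLM.contDiff.comp ψ.contDiff
  have him : ContDiff ℝ ∞ fun x => (ψ x).im := Complex.imCLM.contDiff.comp ψ.contDiff
  have : ψ = ofReal _ hre + Complex.I • ofReal _ him := by
    refine DFunLike.ext _ _ fun x => ?_
    change ψ x = ((ψ x).re : ℂ) + Complex.I * ((ψ x).im : ℂ)
    rw [mul_comm, Complex.re_add_im]
  rw [this, map_add, map_smul, hreal, hreal]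
  simp

end CompactDistribution

/-! ### Kernels and polynomials in the inverted variable -/

theorem MvPolynomial.IsHomogeneous.eval_mul {σ : Type*} {n : ℕ} {p : MvPolynomial σ ℝ}
    (hp : p.IsHomogeneous n) (c : ℝ) (x : σ → ℝ) :
    eval (fun i => c * x i) p = c ^ n * eval x p := by
  rw [eval_eq, eval_eq, Finset.mul_sum]
  refine Finset.sum_congr rfl fun m hm => ?_
  simp_rw [mul_pow]
  rw [Finset.prod_mul_distrib, Finset.prod_pow_eq_pow_sum, ← hp.degree_eq_sum_deg_support hm]
  ring

theorem Continuous.finset_sum_fn {X ι : Type*} [TopologicalSpace X] (s : Finset ι) {g : ι → X → ℝ}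
    (hg : ∀ i ∈ s, Continuous (g i)) : Continuous (∑ i ∈ s, g i) := by
  rw [Finset.sum_fn]
  exact continuous_finsetSum s hg

variable {d : ℕ}

/-- The polynomial function on `ℝᵈ` defined by a polynomial. -/
def polyFun (p : MvPolynomial (Fin d) ℝ) (x : EuclideanSpace ℝ (Fin d)) : ℝ :=
  MvPolynomial.eval (fun i => x i) p

theorem contDiff_polyFun (p : MvPolynomial (Fin d) ℝ) : ContDiff ℝ ∞ (polyFun p) := by
  induction p using MvPolynomial.induction_on with
  | C a =>
    have : polyFun (MvPolynomial.C a : MvPolynomial (Fin d) ℝ) = fun _ => a := by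
      ext; simp [polyFun]
    rw [this]
    exact contDiff_const
  | add p q hp hq =>
    have : polyFun (p + q) = fun x => polyFun p x + polyFun q x := by ext; simp [polyFun]
    rw [this]
    exact hp.add hq
  | mul_X p i hp =>
    have : polyFun (p * MvPolynomial.X i) = fun x => polyFun p x * x i := by ext; simp [polyFun]
    rw [this]
    exact hp.mul (by fun_prop)

theorem fderiv_polyFun_single (p : MvPolynomial (Fin d) ℝ) (i : Fin d)
    (x : EuclideanSpace ℝ (Fin d)) :
    fderiv ℝ (polyFun p) x (EuclideanSpace.single i 1) =
      polyFun (MvPolynomial.pderiv i p) x := by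
  have hdiff : ∀ p : MvPolynomial (Fin d) ℝ, DifferentiableAt ℝ (polyFun p) x := fun p =>
    (contDiff_polyFun p).differentiable (by simp) x
  induction p using MvPolynomial.induction_on with
  | C a =>
    have : polyFun (MvPolynomial.C a : MvPolynomial (Fin d) ℝ) = fun _ => a := by
      ext; simp [polyFun]
    simp [this, polyFun]
  | add p q hp hq =>
    have : polyFun (p + q) = fun x => polyFun p x + polyFun q x := by ext; simp [polyFun]
    rw [this, fderiv_fun_add (hdiff p) (hdiff q), add_apply, hp, hq]
    simp [polyFun]
  | mul_X p j hp =>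
    have : polyFun (p * MvPolynomial.X j) = fun x => polyFun p x * EuclideanSpace.proj j x := by
      ext; simp [polyFun]
    rw [this, fderiv_fun_mul (hdiff p) (EuclideanSpace.proj j).differentiableAt,
      ContinuousLinearMap.fderiv]
    simp only [add_apply, smul_apply, hp, Derivation.leibniz,
      MvPolynomial.pderiv_X, polyFun, smul_eq_mul, map_add, map_mul, MvPolynomial.eval_X]
    by_cases hij : j = i
    · subst hij; simp
    · simp [hij]

/-- `N` is a smooth positive function that agrees with `|x|²` at distance at least `ρ` from the origin.
Its real powers are smooth on all of `ℝᵈ`, unlike those of `|x|²`. -/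
structure IsRegularizedNormSq (N : EuclideanSpace ℝ (Fin d) → ℝ) (ρ : ℝ) : Prop where
  contDiff : ContDiff ℝ ∞ N
  pos : ∀ x, 0 < N x
  eq_norm_sq : ∀ x, ρ ≤ ‖x‖ → N x = ‖x‖ ^ 2

theorem exists_isRegularizedNormSq (d : ℕ) {ρ : ℝ} (hρ : 0 < ρ) :
    ∃ N : EuclideanSpace ℝ (Fin d) → ℝ, IsRegularizedNormSq N ρ := by
  let χ : ContDiffBump (0 : EuclideanSpace ℝ (Fin d)) := ⟨ρ / 2, ρ, by positivity, by linarith⟩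
  refine ⟨fun x => ‖x‖ ^ 2 + χ x, (contDiff_norm_sq ℝ).add χ.contDiff, fun x => ?_, fun x hx => ?_⟩
  · rcases eq_or_ne x 0 with rfl | hx
    · have : χ 0 = 1 := χ.one_of_mem_closedBall (Metric.mem_closedBall_self (by positivity))
      simp [this]
    · have := χ.nonneg (x := x)
      positivity
  · rw [χ.zero_of_le_dist (by simpa using hx), add_zero]

/-- The function `p(x) N(x)^(-μ)`, which for a regularized square of the norm `N` is a smooth version
of `p(x) |x|^(-2μ)`. -/
def polyKernel (N : EuclideanSpace ℝ (Fin d) → ℝ) (μ : ℝ) (p : MvPolynomial (Fin d) ℝ)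
    (x : EuclideanSpace ℝ (Fin d)) : ℝ :=
  polyFun p x * N x ^ (-μ)

section polyKernel

variable {N : EuclideanSpace ℝ (Fin d) → ℝ} {ρ : ℝ}

theorem IsRegularizedNormSq.contDiff_polyKernel (hN : IsRegularizedNormSq N ρ) (μ : ℝ)
    (p : MvPolynomial (Fin d) ℝ) : ContDiff ℝ ∞ (polyKernel N μ p) :=
  (contDiff_polyFun p).mul (hN.contDiff.rpow_const_of_ne fun x => (hN.pos x).ne')

theorem polyKernel_C_mul (μ c : ℝ) (p : MvPolynomial (Fin d) ℝ) :
    polyKernel N μ (MvPolynomial.C c * p) = c • polyKernel N μ p := by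
  ext x
  simp [polyKernel, polyFun, mul_assoc]

theorem polyKernel_sum {ι : Type*} (s : Finset ι) (μ : ℝ) (p : ι → MvPolynomial (Fin d) ℝ) :
    polyKernel N μ (∑ i ∈ s, p i) = ∑ i ∈ s, polyKernel N μ (p i) := by
  ext x
  simp [polyKernel, polyFun, Finset.sum_mul, Finset.sum_apply]

theorem IsRegularizedNormSq.fderiv_polyKernel_single (hN : IsRegularizedNormSq N ρ) (μ : ℝ)
    (p : MvPolynomial (Fin d) ℝ) (i : Fin d) {x : EuclideanSpace ℝ (Fin d)} (hx : ρ < ‖x‖) :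
    fderiv ℝ (polyKernel N μ p) x (EuclideanSpace.single i 1) =
      polyKernel N μ (MvPolynomial.pderiv i p) x +
        -2 * μ * polyKernel N (μ + 1) (MvPolynomial.X i * p) x := by
  have hNx : HasFDerivAt N (2 • innerSL ℝ x) x := by
    refine (hasStrictFDerivAt_norm_sq x).hasFDerivAt.congr_of_eventuallyEq ?_
    filter_upwards [(isOpen_lt continuous_const continuous_norm).mem_nhds hx] with y hy
    exact hN.eq_norm_sq y (le_of_lt hy)
  have h1 := ((contDiff_polyFun p).differentiable (by simp) x).hasFDerivAt.mul
    (hNx.rpow_const (p := -μ) (Or.inl (hN.pos x).ne'))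
  have h2 : fderiv ℝ (polyKernel N μ p) x = _ := h1.fderiv
  rw [h2]
  have e : -μ - 1 = -(μ + 1) := by ring
  simp only [add_apply, smul_apply, fderiv_polyFun_single,
    polyKernel, smul_eq_mul, e, innerSL_apply_apply, EuclideanSpace.inner_single_right]
  simp [polyFun]
  ring

end polyKernel

namespace CompactDistribution.AnnihilatesConvolutions

variable {f : CompactDistribution d} {δ ρ : ℝ} {N : EuclideanSpace ℝ (Fin d) → ℝ}
  {U : Set (EuclideanSpace ℝ (Fin d))}

theorem polyKernel_pderiv (hN : IsRegularizedNormSq N ρ) (hU : IsOpen U)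
    (hf : Distribution.dsupport (f : SmoothFunction d → ℂ) ⊆ U)
    (hUρ : ∀ x ∈ U, ∀ y ∈ Metric.closedBall x δ, ρ < ‖y‖) {μ : ℝ} {p : MvPolynomial (Fin d) ℝ}
    (h : AnnihilatesConvolutions f δ (polyKernel N μ p)) (i : Fin d) :
    AnnihilatesConvolutions f δ (polyKernel N μ (MvPolynomial.pderiv i p) +
      (-2 * μ) • polyKernel N (μ + 1) (MvPolynomial.X i * p)) := by
  refine (h.fderiv_apply (hN.contDiff_polyKernel μ p)
    (EuclideanSpace.single i 1)).congr_of_eqOn hU hf (fun x hx y hy => ?_) ?_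
  · exact hN.fderiv_polyKernel_single μ p i (hUρ x hx y hy)
  · exact (((hN.contDiff_polyKernel μ p).fderiv_right (m := ∞) (by simp)).clm_apply
      contDiff_const).continuous

/-- If the first term in the derivative of a kernel is annihilated, so is the second. -/
theorem polyKernel_X_mul (hN : IsRegularizedNormSq N ρ) (hU : IsOpen U)
    (hf : Distribution.dsupport (f : SmoothFunction d → ℂ) ⊆ U)
    (hUρ : ∀ x ∈ U, ∀ y ∈ Metric.closedBall x δ, ρ < ‖y‖) {μ : ℝ} (hμ : μ ≠ 0)
    {p : MvPolynomial (Fin d) ℝ} (h : AnnihilatesConvolutions f δ (polyKernel N μ p)) (i : Fin d)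
    (h' : AnnihilatesConvolutions f δ (polyKernel N μ (MvPolynomial.pderiv i p))) :
    AnnihilatesConvolutions f δ (polyKernel N (μ + 1) (MvPolynomial.X i * p)) := by
  have c := fun ν q => (hN.contDiff_polyKernel ν q).continuous
  have h1 := ((polyKernel_pderiv hN hU hf hUρ h i).add (h'.const_smul (c _ _) (-1))
    ((c _ _).add ((c _ _).const_smul _)) ((c _ _).const_smul _)).const_smul
    (((c _ _).add ((c _ _).const_smul _)).add ((c _ _).const_smul _)) (-2 * μ)⁻¹
  convert h1 using 1
  ext x
  simp only [Pi.smul_apply, Pi.add_apply, smul_eq_mul]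
  field_simp
  ring

/-- Applying the Laplacian to `|x|^(-2μ)` gives a multiple of `|x|^(-2μ-2)`. -/
theorem polyKernel_one_succ (hN : IsRegularizedNormSq N ρ) (hU : IsOpen U)
    (hf : Distribution.dsupport (f : SmoothFunction d → ℂ) ⊆ U)
    (hUρ : ∀ x ∈ U, ∀ y ∈ Metric.closedBall x δ, ρ < ‖y‖) {μ : ℝ} (hμ : μ ≠ 0)
    (hμd : (d : ℝ) - 2 * (μ + 1) ≠ 0) (h : AnnihilatesConvolutions f δ (polyKernel N μ 1)) :
    AnnihilatesConvolutions f δ (polyKernel N (μ + 1) 1) := by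
  have c := fun ν q => (hN.contDiff_polyKernel ν q).continuous
  have h0 : ∀ ν, polyKernel N ν (0 : MvPolynomial (Fin d) ℝ) = 0 := fun ν => by
    ext x; simp [polyKernel, polyFun]
  have h1 : ∀ i, AnnihilatesConvolutions f δ (polyKernel N (μ + 1) (MvPolynomial.X i)) := by
    intro i
    have := polyKernel_X_mul hN hU hf hUρ hμ h i (by
      rw [MvPolynomial.pderiv_one, h0]; exact zero)
    rwa [mul_one] at this
  have h2 := sum (Finset.univ : Finset (Fin d))
    (fun i _ => polyKernel_pderiv hN hU hf hUρ (h1 i) i)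
    (fun i _ => (c _ _).add ((c _ _).const_smul _))
  have cs : Continuous (∑ i : Fin d, (polyKernel N (μ + 1)
      (MvPolynomial.pderiv i (MvPolynomial.X i)) + (-2 * (μ + 1)) • polyKernel N (μ + 1 + 1)
        (MvPolynomial.X i * MvPolynomial.X i))) :=
    Continuous.finset_sum_fn _ fun i _ => (c _ _).add ((c _ _).const_smul _)
  have h3 := h2.const_smul cs ((d : ℝ) - 2 * (μ + 1))⁻¹
  refine h3.congr_of_eqOn hU hf (fun x hx y hy => ?_) (cs.const_smul _)
  have hy' : N y = ∑ i, y i * y i := by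
    rw [hN.eq_norm_sq y (hUρ x hx y hy).le, EuclideanSpace.real_norm_sq_eq]
    simp [sq]
  have e : N y ^ (-(μ + 1)) = N y * N y ^ (-(μ + 1 + 1)) := by
    have h1 := Real.rpow_add (hN.pos y) 1 (-(μ + 1 + 1))
    rw [Real.rpow_one] at h1
    rw [← h1]
    congr 1
    ring
  simp only [Pi.smul_apply, Finset.sum_apply, Pi.add_apply, smul_eq_mul, polyKernel, polyFun,
    MvPolynomial.pderiv_X_self, map_one, map_mul, MvPolynomial.eval_X, one_mul]
  rw [Finset.sum_add_distrib, ← Finset.mul_sum, ← Finset.sum_mul, ← hy', ← e]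
  simp only [Finset.sum_const, Finset.card_univ, Fintype.card_fin, nsmul_eq_mul]
  field_simp
  ring

/-- Starting from the kernel `|x|^(1-d)`, differentiation produces `p(x) |x|^(1-d-2j)` for every
homogeneous polynomial `p` of degree at most `j`. -/
theorem polyKernel_of_isHomogeneous (hd : 2 ≤ d) (hN : IsRegularizedNormSq N ρ) (hU : IsOpen U)
    (hf : Distribution.dsupport (f : SmoothFunction d → ℂ) ⊆ U)
    (hUρ : ∀ x ∈ U, ∀ y ∈ Metric.closedBall x δ, ρ < ‖y‖)
    (h : AnnihilatesConvolutions f δ (polyKernel N (((d : ℝ) - 1) / 2) 1)) (k : ℕ) :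
    ∀ (p : MvPolynomial (Fin d) ℝ), p.IsHomogeneous k → ∀ j, k ≤ j →
      AnnihilatesConvolutions f δ (polyKernel N (((d : ℝ) - 1) / 2 + j) p) := by
  have c := fun ν q => (hN.contDiff_polyKernel ν q).continuous
  have hd' : (2 : ℝ) ≤ d := by exact_mod_cast hd
  have hpos : ∀ j : ℕ, ((d : ℝ) - 1) / 2 + j ≠ 0 := fun j => by
    have := j.cast_nonneg (α := ℝ)
    linarith
  have hone : ∀ j : ℕ, AnnihilatesConvolutions f δ (polyKernel N (((d : ℝ) - 1) / 2 + j) 1) := by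
    intro j
    induction j with
    | zero => simpa using h
    | succ j ih =>
      have := polyKernel_one_succ hN hU hf hUρ (hpos j) (by
        have := j.cast_nonneg (α := ℝ)
        linarith) ih
      rwa [add_assoc, ← Nat.cast_succ] at this
  induction k using Nat.strong_induction_on with
  | _ k ih =>
    intro p hp j hkj
    rcases k with _ | k
    · obtain ⟨a, rfl⟩ : ∃ a, p = MvPolynomial.C a :=
        ⟨_, MvPolynomial.totalDegree_eq_zero_iff_eq_C.1
          ((MvPolynomial.totalDegree_zero_iff_isHomogeneous _).2 hp)⟩
      rw [← mul_one (MvPolynomial.C a), polyKernel_C_mul]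
      exact (hone j).const_smul (c _ _) a
    · obtain ⟨j, rfl⟩ : ∃ j', j = j' + 1 := ⟨j - 1, by omega⟩
      have hi : ∀ i, AnnihilatesConvolutions f δ (polyKernel N (((d : ℝ) - 1) / 2 + (j + 1 : ℕ))
          (MvPolynomial.X i * MvPolynomial.pderiv i p)) := by
        intro i
        have hq : (MvPolynomial.pderiv i p).IsHomogeneous k := by simpa using hp.pderiv (i := i)
        have := polyKernel_X_mul hN hU hf hUρ (hpos j) (ih k (by omega) _ hq j (by omega)) i
          (ih (k - 1) (by omega) _ hq.pderiv j (by omega))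
        rwa [add_assoc, ← Nat.cast_succ] at this
      -- Euler's identity recovers `p` from its partial derivatives.
      have hE : p = MvPolynomial.C ((k + 1 : ℝ)⁻¹) *
          ∑ i, MvPolynomial.X i * MvPolynomial.pderiv i p := by
        rw [hp.sum_X_mul_pderiv, nsmul_eq_mul, ← mul_assoc]
        have : ((k + 1 : ℕ) : MvPolynomial (Fin d) ℝ) = MvPolynomial.C (k + 1 : ℝ) := by simp
        rw [this, ← map_mul, inv_mul_cancel₀ (by positivity), map_one, one_mul]
      rw [hE, polyKernel_C_mul, polyKernel_sum]
      exact (sum _ (fun i _ => hi i) fun i _ => c _ _).const_smul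
        (Continuous.finset_sum_fn _ fun i _ => c _ _) _

/-- The kernels obtained by differentiation, written in the inverted variable `x / |x|²`, are all
polynomials times a fixed power of the norm. -/
theorem eval_inversion (hd : 2 ≤ d) (hN : IsRegularizedNormSq N ρ) (hU : IsOpen U)
    (hf : Distribution.dsupport (f : SmoothFunction d → ℂ) ⊆ U)
    (hUρ : ∀ x ∈ U, ∀ y ∈ Metric.closedBall x δ, ρ < ‖y‖)
    (h : AnnihilatesConvolutions f δ (polyKernel N (((d : ℝ) - 1) / 2) 1))
    (q : MvPolynomial (Fin d) ℝ) :
    AnnihilatesConvolutions f δ fun x =>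
      N x ^ (-(((d : ℝ) - 1) / 2)) * MvPolynomial.eval (fun i => (N x)⁻¹ * x i) q := by
  have : (fun x => N x ^ (-(((d : ℝ) - 1) / 2)) * MvPolynomial.eval (fun i => (N x)⁻¹ * x i) q) =
      ∑ k ∈ Finset.range (q.totalDegree + 1), polyKernel N (((d : ℝ) - 1) / 2 + k)
        (MvPolynomial.homogeneousComponent k q) := by
    ext x
    conv_lhs => rw [← MvPolynomial.sum_homogeneousComponent q, map_sum, Finset.mul_sum]
    rw [Finset.sum_apply]
    refine Finset.sum_congr rfl fun k _ => ?_
    rw [(MvPolynomial.homogeneousComponent_isHomogeneous k q).eval_mul, polyKernel, polyFun,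
      neg_add, Real.rpow_add (hN.pos x), Real.rpow_neg (hN.pos x).le (k : ℝ), Real.rpow_natCast,
      inv_pow]
    ring
  rw [this]
  exact sum _ (fun k _ => polyKernel_of_isHomogeneous hd hN hU hf hUρ h k _
    (MvPolynomial.homogeneousComponent_isHomogeneous k q) k le_rfl)
    fun k _ => (hN.contDiff_polyKernel _ _).continuous

/-- By the Stone-Weierstrass theorem in the inverted variable, `f` annihilates all convolutions. -/
theorem of_polyKernel_one (hd : 2 ≤ d) (hN : IsRegularizedNormSq N ρ) (hρ : 0 < ρ) (hU : IsOpen U)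
    (hf : Distribution.dsupport (f : SmoothFunction d → ℂ) ⊆ U)
    (hUρ : ∀ x ∈ U, ∀ y ∈ Metric.closedBall x δ, ρ < ‖y‖) {R : ℝ}
    (hUR : ∀ x ∈ U, ∀ y ∈ Metric.closedBall x δ, ‖y‖ ≤ R)
    (h : AnnihilatesConvolutions f δ (polyKernel N (((d : ℝ) - 1) / 2) 1))
    {g : EuclideanSpace ℝ (Fin d) → ℝ} (hg : Continuous g) : AnnihilatesConvolutions f δ g := by
  set lam : ℝ := ((d : ℝ) - 1) / 2 with hlam
  have hlam0 : 0 ≤ lam := by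
    have : (2 : ℝ) ≤ d := by exact_mod_cast hd
    rw [hlam]; linarith
  have hNc : Continuous N := hN.contDiff.continuous
  have hNpow : ∀ a : ℝ, Continuous fun x => N x ^ a := fun a =>
    hNc.rpow_const fun x => Or.inl (hN.pos x).ne'
  let K : Set (EuclideanSpace ℝ (Fin d)) := {y | ρ ≤ ‖y‖} ∩ Metric.closedBall 0 R
  have hK : IsCompact K :=
    (isCompact_closedBall 0 R).inter_left (isClosed_le continuous_const continuous_norm)
  have : CompactSpace K := isCompact_iff_compactSpace.1 hK
  let w : Fin d → C(K, ℝ) := fun i => ⟨fun x => (N x.1)⁻¹ * x.1 i, by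
    refine Continuous.mul ?_ (by fun_prop)
    exact (hNc.comp continuous_subtype_val).inv₀ fun x => (hN.pos x.1).ne'⟩
  have hw : ∀ (q : MvPolynomial (Fin d) ℝ) (x : K), MvPolynomial.aeval w q x =
      MvPolynomial.eval (fun i => (N x.1)⁻¹ * x.1 i) q := by
    intro q x
    induction q using MvPolynomial.induction_on with
    | C a => simp
    | add p q hp hq => simp [hp, hq]
    | mul_X p i hp => simp [hp, w]
  have hsep : (MvPolynomial.aeval w : MvPolynomial (Fin d) ℝ →ₐ[ℝ] C(K, ℝ)).range.SeparatesPoints := by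
    intro x y hxy
    by_contra! hcon
    -- The inversion `x ↦ x / |x|²` is injective.
    have hval : ∀ i, (N x.1)⁻¹ * x.1 i = (N y.1)⁻¹ * y.1 i := fun i => by
      have := hcon (w i) ⟨w i, ⟨MvPolynomial.X i, by simp⟩, rfl⟩
      exact this
    have hvec : (N x.1)⁻¹ • x.1 = (N y.1)⁻¹ • y.1 := by
      ext i; simpa using hval i
    have hxn : 0 < ‖x.1‖ := hρ.trans_le x.2.1
    have hyn : 0 < ‖y.1‖ := hρ.trans_le y.2.1
    have hnorm := congrArg norm hvec
    rw [hN.eq_norm_sq _ x.2.1, hN.eq_norm_sq _ y.2.1, norm_smul, norm_smul, norm_inv, norm_inv,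
      norm_pow, norm_pow, norm_norm, norm_norm] at hnorm
    have hnorm' : ‖x.1‖ = ‖y.1‖ := by
      field_simp at hnorm
      linarith
    rw [hN.eq_norm_sq _ x.2.1, hN.eq_norm_sq _ y.2.1, hnorm'] at hvec
    exact hxy (Subtype.ext (smul_right_injective _ (by positivity) hvec))
  refine of_forall_sub_le hg fun ε hε => ?_
  let G : C(K, ℝ) := ⟨fun x => N x.1 ^ lam * g x.1, by
    exact ((hNpow lam).comp continuous_subtype_val).mul (hg.comp continuous_subtype_val)⟩
  obtain ⟨⟨P, q, rfl⟩, hP⟩ := ContinuousMap.exists_mem_subalgebra_near_continuousMap_of_separatesPoints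
    _ hsep G (ε * (ρ ^ 2) ^ lam) (by positivity)
  let h' : EuclideanSpace ℝ (Fin d) → ℝ := fun x =>
    N x ^ (-lam) * MvPolynomial.eval (fun i => (N x)⁻¹ * x i) q
  have ch' : Continuous h' := by
    refine (hNpow _).mul ?_
    refine (MvPolynomial.continuous_eval q).comp (continuous_pi fun i => ?_)
    exact (hNc.inv₀ fun x => (hN.pos x).ne').mul (by fun_prop)
  have hbound : ∀ x ∈ K, |g x - h' x| ≤ ε := by
    intro x hx
    have h1 := (ContinuousMap.norm_coe_le_norm _ (⟨x, hx⟩ : K)).trans_lt hP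
    have h1' : |MvPolynomial.aeval w q ⟨x, hx⟩ - N x ^ lam * g x| < ε * (ρ ^ 2) ^ lam := h1
    rw [hw] at h1'
    have hNx : 0 < N x ^ lam := Real.rpow_pos_of_pos (hN.pos x) _
    have h2 : (ρ ^ 2) ^ lam ≤ N x ^ lam := by
      refine Real.rpow_le_rpow (by positivity) ?_ hlam0
      rw [hN.eq_norm_sq x hx.1]
      exact pow_le_pow_left₀ hρ.le hx.1 2
    have h3 : N x ^ lam * (g x - h' x) =
        -(MvPolynomial.eval (fun i => (N x)⁻¹ * x i) q - N x ^ lam * g x) := by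
      simp only [h', Real.rpow_neg (hN.pos x).le]
      field_simp
      ring
    have h4 : N x ^ lam * |g x - h' x| ≤ N x ^ lam * ε := by
      rw [← abs_of_pos hNx, ← abs_mul, h3, abs_neg, abs_of_pos hNx]
      exact h1'.le.trans (by rw [mul_comm]; exact mul_le_mul_of_nonneg_right h2 hε.le)
    exact le_of_mul_le_mul_left h4 hNx
  -- Truncating the error makes it small everywhere without changing it on `K`.
  refine ⟨fun x => max (-ε) (min ε (g x - h' x)), by fun_prop, fun x => ?_, ?_⟩
  · rw [abs_le]
    exact ⟨le_max_left _ _, max_le (by linarith) (min_le_left _ _)⟩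
  · refine (eval_inversion hd hN hU hf hUρ h q).congr_of_eqOn hU hf (fun x hx y hy => ?_) ch'
    have hyK : y ∈ K := ⟨(hUρ x hx y hy).le, by simpa using hUR x hx y hy⟩
    have := abs_le.1 (hbound y hyK)
    change h' y = g y - max (-ε) (min ε (g y - h' y))
    rw [min_eq_right this.2, max_eq_right this.1]
    ring

end CompactDistribution.AnnihilatesConvolutions

/-! ### The normal operator of the X-ray transform -/

/-- Integration in polar coordinates. -/
theorem MeasureTheory.integral_eq_integral_toSphere {E F : Type*} [NormedAddCommGroup E]
    [NormedSpace ℝ E] [FiniteDimensional ℝ E] [Nontrivial E] [MeasurableSpace E] [BorelSpace E]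
    [NormedAddCommGroup F] [NormedSpace ℝ F] (μ : Measure E) [μ.IsAddHaarMeasure] {g : E → F}
    (hg : Integrable g μ) :
    ∫ x, g x ∂μ = ∫ θ, (∫ s in Set.Ioi (0 : ℝ),
      s ^ (Module.finrank ℝ E - 1) • g (s • θ.1)) ∂μ.toSphere := by
  let G : Metric.sphere (0 : E) 1 × Set.Ioi (0 : ℝ) → F := fun p => g (p.2.1 • p.1.1)
  have hG : ∀ x, G (homeomorphUnitSphereProd E x) = g x.1 := fun x => by
    have : ‖x.1‖ ≠ 0 := norm_ne_zero_iff.2 x.2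
    simp [G, smul_smul, this]
  have hmp := μ.measurePreserving_homeomorphUnitSphereProd
  have hemb := (homeomorphUnitSphereProd E).measurableEmbedding
  have hGint : Integrable G (μ.toSphere.prod (.volumeIoiPow (Module.finrank ℝ E - 1))) := by
    rw [← hmp.integrable_comp_emb hemb]
    have : G ∘ homeomorphUnitSphereProd E = fun x => g x.1 := funext hG
    rw [this]
    exact (integrableOn_iff_comap_subtypeVal (measurableSet_singleton (0 : E)).compl).1
      hg.integrableOn
  calc ∫ x, g x ∂μ = ∫ x : ({0}ᶜ : Set E), g x.1 ∂(μ.comap (↑)) := by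
        rw [integral_subtype_comap (measurableSet_singleton _).compl g,
          restrict_compl_singleton]
    _ = ∫ p, G p ∂(μ.toSphere.prod (.volumeIoiPow (Module.finrank ℝ E - 1))) := by
        rw [← hmp.integral_comp hemb]
        exact integral_congr_ae (Eventually.of_forall fun x => (hG x).symm)
    _ = _ := by
        rw [integral_prod _ hGint]
        refine integral_congr_ae (Eventually.of_forall fun θ => ?_)
        simp only [Measure.volumeIoiPow, ENNReal.ofReal, G]
        rw [integral_withDensity_eq_integral_smul,
          integral_subtype_comap measurableSet_Ioi fun s : ℝ =>
            Real.toNNReal (s ^ (Module.finrank ℝ E - 1)) • g (s • θ.1)]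
        · refine setIntegral_congr_fun measurableSet_Ioi fun s hs => ?_
          simp only [NNReal.smul_def]
          rw [Real.coe_toNNReal _ (pow_nonneg (le_of_lt hs) _)]
        · exact (measurable_subtype_coe.pow_const _).real_toNNReal

variable {d : ℕ}

/-- The Jacobian `s^(d-1)` of polar coordinates cancels against the kernel `|v|^(1-d)`. -/
theorem IsRegularizedNormSq.integral_toSphere_eq {N : EuclideanSpace ℝ (Fin d) → ℝ} {ρ : ℝ}
    (hN : IsRegularizedNormSq N ρ) (hd : 2 ≤ d) {ψ : EuclideanSpace ℝ (Fin d) → ℝ}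
    (hψ : Continuous ψ) (hc : HasCompactSupport ψ) (h0 : ∀ v, ‖v‖ ≤ ρ → ψ v = 0) :
    ∫ θ, (∫ s in Set.Ioi (0 : ℝ), ψ (s • θ.1))
        ∂(volume : Measure (EuclideanSpace ℝ (Fin d))).toSphere =
      ∫ v, ψ v * N v ^ (-(((d : ℝ) - 1) / 2)) := by
  have : Nontrivial (EuclideanSpace ℝ (Fin d)) := by
    have : Nonempty (Fin d) := ⟨⟨0, by omega⟩⟩
    infer_instance
  have hint : Integrable (fun v => ψ v * N v ^ (-(((d : ℝ) - 1) / 2))) volume :=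
    (hψ.mul (hN.contDiff.continuous.rpow_const fun x => Or.inl (hN.pos x).ne')
      ).integrable_of_hasCompactSupport hc.mul_right
  rw [integral_eq_integral_toSphere volume hint, finrank_euclideanSpace_fin]
  refine integral_congr_ae (Eventually.of_forall fun θ =>
    setIntegral_congr_fun measurableSet_Ioi fun s hs => ?_)
  have hθ : ‖s • θ.1‖ = s := by
    rw [norm_smul, norm_eq_of_mem_sphere θ, mul_one, Real.norm_of_nonneg (le_of_lt hs)]
  rcases le_or_gt s ρ with h | h
  · simp [h0 (s • θ.1) (by rwa [hθ])]
  · have hs' : (0 : ℝ) < s := hs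
    have e : s ^ (d - 1) * (s ^ 2) ^ (-(((d : ℝ) - 1) / 2)) = 1 := by
      rw [← Real.rpow_natCast s (d - 1), ← Real.rpow_natCast s 2, ← Real.rpow_mul hs'.le,
        ← Real.rpow_add hs', Nat.cast_sub (by omega)]
      convert Real.rpow_zero s using 2
      push_cast
      ring
    simp only [smul_eq_mul]
    rw [hN.eq_norm_sq _ (by rw [hθ]; exact h.le), hθ, mul_left_comm, e, mul_one]

/-- The integral of `φ` over the line `{z + s θ : s ∈ ℝ}`. -/
def lineIntegral (φ : EuclideanSpace ℝ (Fin d) → ℝ)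
    (p : EuclideanSpace ℝ (Fin d) × EuclideanSpace ℝ (Fin d)) : ℝ :=
  ∫ s : ℝ, φ (p.1 + s • p.2)

section lineIntegral

variable {φ : EuclideanSpace ℝ (Fin d) → ℝ} {δ : ℝ}

/-- Where `z` is bounded and `θ` stays away from zero, the integrand is supported in a fixed compact
interval of parameters. -/
theorem contDiffOn_lineIntegral (hφ : ContDiff ℝ ∞ φ)
    (hs : tsupport φ ⊆ Metric.closedBall 0 δ) (M : ℝ) :
    ContDiffOn ℝ ∞ (lineIntegral φ) {p | ‖p.1‖ < M ∧ 1 / 2 < ‖p.2‖} := by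
  have hopen : IsOpen {p : EuclideanSpace ℝ (Fin d) × EuclideanSpace ℝ (Fin d) |
      ‖p.1‖ < M ∧ 1 / 2 < ‖p.2‖} :=
    (isOpen_lt continuous_fst.norm continuous_const).inter
      (isOpen_lt continuous_const continuous_snd.norm)
  -- The line integral is the convolution of `1` with `s ↦ φ (z - s θ)`, evaluated at `0`.
  have h := contDiffOn_convolution_right_with_param_comp (μ := (volume : Measure ℝ)) (n := ⊤)
    (ContinuousLinearMap.lsmul ℝ ℝ : ℝ →L[ℝ] ℝ →L[ℝ] ℝ) (v := fun _ => (0 : ℝ)) contDiffOn_const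
    (f := fun _ : ℝ => (1 : ℝ))
    (g := fun (p : EuclideanSpace ℝ (Fin d) × EuclideanSpace ℝ (Fin d)) (s : ℝ) =>
      φ (p.1 - s • p.2))
    (k := Metric.closedBall 0 (2 * (M + δ))) hopen (isCompact_closedBall _ _) ?_
    (locallyIntegrable_const 1) ?_
  · refine h.congr fun p _ => ?_
    rw [convolution_def, lineIntegral]
    simp
  · rintro ⟨z, θ⟩ s ⟨hz, hθ⟩ hsk
    refine image_eq_zero_of_notMem_tsupport fun hmem => hsk ?_
    have h1 := hs hmem
    rw [mem_closedBall_zero_iff] at h1 ⊢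
    simp only at hz hθ h1
    have h2 : ‖s • θ‖ ≤ ‖z‖ + ‖z - s • θ‖ := by
      have := norm_sub_le z (z - s • θ)
      rwa [sub_sub_cancel] at this
    rw [norm_smul] at h2
    nlinarith [norm_nonneg s]
  · have : ContDiff ℝ ∞ fun q : (EuclideanSpace ℝ (Fin d) × EuclideanSpace ℝ (Fin d)) × ℝ =>
        φ (q.1.1 - q.2 • q.1.2) := hφ.comp (by fun_prop)
    exact this.contDiffOn

theorem lineIntegral_eq_zero (hs : tsupport φ ⊆ Metric.closedBall 0 δ) (γ : OrientedLine d)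
    (hγ : δ < ‖γ.1.1‖) : lineIntegral φ γ.1 = 0 := by
  refine integral_eq_zero_of_ae (Eventually.of_forall fun s => ?_)
  refine image_eq_zero_of_notMem_tsupport fun hmem => ?_
  have h1 := hs hmem
  rw [mem_closedBall_zero_iff] at h1
  have h2 : ‖γ.1.1 + s • γ.1.2‖ ^ 2 = ‖γ.1.1‖ ^ 2 + s ^ 2 := by
    rw [norm_add_sq_real, real_inner_smul_right, γ.2.2, norm_smul, γ.2.1]
    simp
  have h3 : ‖γ.1.1‖ ≤ ‖γ.1.1 + s • γ.1.2‖ :=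
    abs_le_of_sq_le_sq' (by rw [h2]; nlinarith) (norm_nonneg _) |>.2
  linarith

/-- The X-ray transform of a test function, as a smooth function of lines. -/
def testFunctionXray (hφ : ContDiff ℝ ∞ φ) (hs : tsupport φ ⊆ Metric.closedBall 0 δ) :
    smoothOnLines d :=
  ⟨fun γ => (lineIntegral φ γ.1 : ℂ), fun γ =>
    ⟨{p | ‖p.1‖ < ‖γ.1.1‖ + 1 ∧ 1 / 2 < ‖p.2‖},
      (isOpen_lt continuous_fst.norm continuous_const).inter
        (isOpen_lt continuous_const continuous_snd.norm),
      ⟨by linarith, by rw [γ.2.1]; norm_num⟩, fun p => (lineIntegral φ p : ℂ),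
      Complex.ofRealCLM.contDiff.comp_contDiffOn (contDiffOn_lineIntegral hφ hs _),
      fun _ _ => rfl⟩⟩

theorem isCompact_orientedLine_norm_le (δ : ℝ) : IsCompact {γ : OrientedLine d | ‖γ.1.1‖ ≤ δ} := by
  have hcl : IsClosed {p : EuclideanSpace ℝ (Fin d) × EuclideanSpace ℝ (Fin d) |
      ‖p.2‖ = 1 ∧ inner ℝ p.1 p.2 = 0} :=
    (isClosed_eq continuous_snd.norm continuous_const).inter
      (isClosed_eq (continuous_fst.inner continuous_snd) continuous_const)
  refine (hcl.isClosedEmbedding_subtypeVal.isCompact_preimage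
    ((isCompact_closedBall 0 δ).prod (isCompact_closedBall 0 1))).of_isClosed_subset
    (isClosed_le (continuous_fst.comp continuous_subtype_val).norm continuous_const) ?_
  intro γ hγ
  exact ⟨by simpa using hγ, by simpa using γ.2.1.le⟩

theorem tsupport_testFunctionXray_subset (hφ : ContDiff ℝ ∞ φ)
    (hs : tsupport φ ⊆ Metric.closedBall 0 δ) :
    tsupport (testFunctionXray hφ hs).1 ⊆ {γ | ‖γ.1.1‖ ≤ δ} := by
  refine closure_minimal (fun γ hγ => ?_) (isCompact_orientedLine_norm_le δ).isClosed
  by_contra hlt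
  refine hγ ?_
  change ((lineIntegral φ γ.1 : ℝ) : ℂ) = 0
  rw [lineIntegral_eq_zero hs γ (not_le.1 hlt), Complex.ofReal_zero]

/-- The line through `x`, split into the two rays that start at `x`. -/
theorem lineIntegral_lineThrough (hφ : Continuous φ) (hc : HasCompactSupport φ)
    (x : EuclideanSpace ℝ (Fin d)) (θ : Metric.sphere (0 : EuclideanSpace ℝ (Fin d)) 1) :
    lineIntegral φ (lineThrough x θ).1 =
      ∫ s in Set.Ioi (0 : ℝ), (φ (x + s • θ.1) + φ (x - s • θ.1)) := by
  have hθ : θ.1 ≠ 0 := fun h => by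
    have := norm_eq_of_mem_sphere θ
    rw [h, norm_zero] at this
    exact zero_ne_one this
  have hemb : Topology.IsClosedEmbedding fun s : ℝ => x + s • θ.1 :=
    (Homeomorph.addLeft x).isClosedEmbedding.comp (isClosedEmbedding_smul_left hθ)
  have hint : Integrable fun s : ℝ => φ (x + s • θ.1) :=
    (hφ.comp hemb.continuous).integrable_of_hasCompactSupport (hc.comp_isClosedEmbedding hemb)
  have h1 : lineIntegral φ (lineThrough x θ).1 = ∫ s : ℝ, φ (x + s • θ.1) := by
    rw [← integral_add_right_eq_self (μ := volume) _ (-inner ℝ x θ.1)]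
    refine integral_congr_ae (Eventually.of_forall fun s => ?_)
    simp only [lineThrough]
    congr 1
    module
  have h2 : ∫ s in Set.Ioi (0 : ℝ), φ (x - s • θ.1) = ∫ s in Set.Iic (0 : ℝ), φ (x + s • θ.1) := by
    have := integral_comp_neg_Ioi (0 : ℝ) fun s : ℝ => φ (x + s • θ.1)
    simpa [neg_smul, ← sub_eq_add_neg] using this
  have hint' : Integrable fun s : ℝ => φ (x - s • θ.1) := by
    simpa [neg_smul, ← sub_eq_add_neg] using hint.comp_neg
  rw [h1, integral_add hint.integrableOn hint'.integrableOn, h2, add_comm,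
    intervalIntegral.integral_Iic_add_Ioi hint.integrableOn hint.integrableOn]

/-- The normal operator of the X-ray transform is the convolution with `2 |x|^(1-d)`. -/
theorem backprojection_testFunctionXray {N : EuclideanSpace ℝ (Fin d) → ℝ} {ρ : ℝ}
    (hN : IsRegularizedNormSq N ρ) (hd : 2 ≤ d) (hφ : ContDiff ℝ ∞ φ)
    (hs : tsupport φ ⊆ Metric.closedBall 0 δ) {x : EuclideanSpace ℝ (Fin d)}
    (hx : ρ + δ < ‖x‖) :
    backprojection (testFunctionXray hφ hs).1 x =
      2 * ((φ ⋆[ContinuousLinearMap.lsmul ℝ ℝ, volume]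
        polyKernel N (((d : ℝ) - 1) / 2) 1) x : ℝ) := by
  have hc := hasCompactSupport_of_tsupport_subset_closedBall hs
  have hc1 : HasCompactSupport fun v => φ (x + v) := hc.comp_homeomorph (Homeomorph.addLeft x)
  have hc2 : HasCompactSupport fun v => φ (x - v) := hc.comp_homeomorph (Homeomorph.subLeft x)
  have c1 : Continuous fun v => φ (x + v) := hφ.continuous.comp (by fun_prop)
  have c2 : Continuous fun v => φ (x - v) := hφ.continuous.comp (by fun_prop)
  have hfar : ∀ v, ‖v‖ ≤ ρ → φ (x + v) = 0 := fun v hv => by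
    refine image_eq_zero_of_notMem_tsupport fun hmem => ?_
    have h1 := hs hmem
    rw [mem_closedBall_zero_iff] at h1
    have h2 := norm_sub_le (x + v) v
    rw [add_sub_cancel_right] at h2
    linarith
  have hfar' : ∀ v, ‖v‖ ≤ ρ → φ (x - v) = 0 := fun v hv => by
    rw [sub_eq_add_neg]; exact hfar _ (by rwa [norm_neg])
  have cN : Continuous fun v => N v ^ (-(((d : ℝ) - 1) / 2)) :=
    hN.contDiff.continuous.rpow_const fun x => Or.inl (hN.pos x).ne'
  have hI2 : ∫ v, φ (x - v) * N v ^ (-(((d : ℝ) - 1) / 2)) =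
      (φ ⋆[ContinuousLinearMap.lsmul ℝ ℝ, volume] polyKernel N (((d : ℝ) - 1) / 2) 1) x := by
    rw [convolution_eq_swap]
    simp [polyKernel, polyFun]
  have hI1 : ∫ v, φ (x + v) * N v ^ (-(((d : ℝ) - 1) / 2)) =
      (φ ⋆[ContinuousLinearMap.lsmul ℝ ℝ, volume] polyKernel N (((d : ℝ) - 1) / 2) 1) x := by
    rw [← hI2, ← integral_neg_eq_self]
    refine integral_congr_ae (Eventually.of_forall fun v => ?_)
    simp only [← sub_eq_add_neg]
    rcases le_total ‖v‖ ρ with hv | hv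
    · rw [hfar' v hv, zero_mul, zero_mul]
    · rw [hN.eq_norm_sq v hv, hN.eq_norm_sq (-v) (by rwa [norm_neg]), norm_neg]
  have h := hN.integral_toSphere_eq hd (ψ := fun v => φ (x + v) + φ (x - v)) (c1.add c2)
    (hc1.add hc2) (fun v hv => by simp [hfar v hv, hfar' v hv])
  have i1 : Integrable fun v => φ (x + v) * N v ^ (-(((d : ℝ) - 1) / 2)) :=
    (c1.mul cN).integrable_of_hasCompactSupport hc1.mul_right
  have i2 : Integrable fun v => φ (x - v) * N v ^ (-(((d : ℝ) - 1) / 2)) :=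
    (c2.mul cN).integrable_of_hasCompactSupport hc2.mul_right
  simp only [add_mul] at h
  rw [integral_add i1 i2, hI1, hI2, ← two_mul] at h
  have h' : backprojection (testFunctionXray hφ hs).1 x =
      ((∫ θ, lineIntegral φ (lineThrough x θ).1
        ∂(volume : Measure (EuclideanSpace ℝ (Fin d))).toSphere : ℝ) : ℂ) := integral_ofReal
  rw [h']
  simp only [lineIntegral_lineThrough hφ.continuous hc]
  rw [h]
  push_cast
  rfl

end lineIntegral

end

theorem corollary3 (d : ℕ) (hd : 2 ≤ d) (r R : ℝ) (hr : 0 < r) (hR : r < R)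
    (f : CompactDistribution d)
    (hsupp : Distribution.dsupport (f : SmoothFunction d → ℂ) ⊆
      Metric.closedBall (0 : EuclideanSpace ℝ (Fin d)) R \
        Metric.ball (0 : EuclideanSpace ℝ (Fin d)) r)
    (hX : XrayVanishesOnLinesMeeting f (Metric.ball (0 : EuclideanSpace ℝ (Fin d)) r)) :
    f = 0 := by
  obtain ⟨N, hN⟩ := exists_isRegularizedNormSq d (half_pos hr)
  let U : Set (EuclideanSpace ℝ (Fin d)) := {x | r / 2 + r / 4 < ‖x‖} ∩ Metric.ball 0 (R + 1)
  have hU : IsOpen U := (isOpen_lt continuous_const continuous_norm).inter Metric.isOpen_ball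
  have hfU : Distribution.dsupport (f : SmoothFunction d → ℂ) ⊆ U := fun x hx => by
    obtain ⟨h1, h2⟩ := hsupp hx
    rw [mem_closedBall_zero_iff] at h1
    rw [mem_ball_zero_iff, not_lt] at h2
    exact ⟨by change r / 2 + r / 4 < ‖x‖; linarith, by rw [mem_ball_zero_iff]; linarith⟩
  have hdist : ∀ x : EuclideanSpace ℝ (Fin d), ∀ y ∈ Metric.closedBall x (r / 4),
      ‖x‖ ≤ ‖y‖ + r / 4 ∧ ‖y‖ ≤ ‖x‖ + r / 4 := fun x y hy => by
    rw [Metric.mem_closedBall, dist_eq_norm] at hy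
    have h1 := norm_sub_norm_le y x
    have h2 := norm_sub_norm_le x y
    rw [norm_sub_rev] at h2
    constructor <;> linarith
  refine CompactDistribution.eq_zero_of_annihilatesConvolutions f (δ := r / 4) (by positivity)
    fun h hh => CompactDistribution.AnnihilatesConvolutions.of_polyKernel_one hd hN (half_pos hr)
      hU hfU (R := R + 1 + r / 4) (fun x hx y hy => ?_) (fun x hx y hy => ?_) ?_ hh.continuous
  · have h1 : r / 2 + r / 4 < ‖x‖ := hx.1
    linarith [hdist x y hy]
  · have h1 := mem_ball_zero_iff.1 hx.2
    linarith [hdist x y hy]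
  · intro φ hφ hs hc
    have hη := hX (testFunctionXray hφ hs)
      ((isCompact_orientedLine_norm_le (r / 4)).of_isClosed_subset (isClosed_tsupport _)
        (tsupport_testFunctionXray_subset hφ hs))
      (fun γ hγ => ⟨0, by
        have : ‖γ.1.1‖ ≤ r / 4 := tsupport_testFunctionXray_subset hφ hs hγ
        rw [mem_ball_zero_iff, zero_smul, add_zero]
        linarith⟩)
    have hcongr : f (xrayAdjoint d (testFunctionXray hφ hs)) =
        f ((2 : ℂ) • SmoothFunction.ofReal _ hc) :=
      f.congr_of_eqOn hU hfU fun x hx => backprojection_testFunctionXray hN hd hφ hs hx.1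
    have h0 : f ((2 : ℂ) • SmoothFunction.ofReal _ hc) = 0 := hcongr.symm.trans hη
    rw [map_smul, smul_eq_zero] at h0
    exact h0.resolve_left two_ne_zero
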